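/- Let $K$ be a field of characteristic $0$, let $q\in K\setminus\{0\}$ be not a root of unity, and let $K[t,\sigma]\subseteq K(t)[\sigma]$ be the rings of polynomials in $\sigma$ with (left) coefficients in $K[t]$, respectively $K(t)$, and commutation rule $\sigma t=q\,t\,\sigma$ (constants of $K$ commute with $\sigma$). The subring $K[\sigma]$ is a commutative polynomial ring. For $A\in K[t,\sigma]^{m\times m}$ write $A=t^{\ell}\tilde A_\ell+\dots+t\tilde A_1+\tilde A_0$ with $\tilde A_i\in K[\sigma]^{m\times m}$; $\tilde A_0$ is the *$t$-trailing matrix* of $A$. Call $A$ *regular* if its rows are left linearly independent over $K(t)[\sigma]$, and call a matrix over $K[\sigma]$ *regular* if its rows are linearly independent over $K[\sigma]$. A matrix $B\in K[t,\sigma]^{m\times m}$ is *equivalent* to $A$ if $B=QA$ for some $Q\in K(t)[\sigma]^{m\times m}$ having a two-sided inverse over $K(t)[\sigma]$. If $A=\sum_{j=0}^{s}A_j\sigma^j$ with $A_j\in K[t]^{m\times m}$, then $A$ is *$t$-tail regular* if $\lambda=\det\bigl(\sum_{j=0}^{s}A_j(0)\,x^j\bigr)\in K[x]$ is not the zero polynomial.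 Order the monomials $e_i\sigma^a$ of $K[\sigma]^{1\times m}$ by $e_i\sigma^a\le e_j\sigma^b$ iff $a<b$, or $a=b$ and $i\ge j$. A matrix over $K[\sigma]$ is in *Popov normal form* if its rows form a minimal Gröbner basis of the module they generate with respect to this ordering (the rows are nonzero with leading coefficient $1$; the leading monomial of every nonzero element of the module is divisible by the leading monomial of a row; and no leading monomial of a row divides that of another row). Consider the following algorithm, whose input is a regular matrix $A\in K[t,\sigma]^{m\times m}$. 1. Compute the $t$-trailing matrix $\tilde A_0$ of $A$. If $\det\tilde A_0\neq0$, return $A$. 2. Otherwise choose $r\le m$ and a matrix $X$ invertible over $K[\sigma]$ such that $X\tilde A_0=\begin{pmatrix}\tilde B_0\\0\end{pmatrix}$ with $\tilde B_0\in K[\sigma]^{r\times m}$ in Popov normal form. Set $A\leftarrow XA$. 3. Set $A\leftarrow TA$ with $T=\operatorname{diag}(1_r,\,t^{-1}1_{m-r})$. The $t$-trailing matrix of $A$ is now $\begin{pmatrix}\tilde B_0\\\tilde C_0\end{pmatrix}$ for some $\tilde C_0\in K[\sigma]^{(m-r)\times m}$. 4. By Gröbner basis reduction, write $\tilde C_0=X\tilde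 B_0+Y$ with matrices $X,Y$ over $K[\sigma]$, where no monomial occurring in a row of $Y$ is divisible by the leading monomial of a row of $\tilde B_0$. Set $A\leftarrow\begin{pmatrix}1_r&0\\-X&1_{m-r}\end{pmatrix}A$. 5. If $Y=0$, go to step 3; otherwise go to step 1. **Theorem 4.1.** For every regular $A\in K[t,\sigma]^{m\times m}$, and whichever choices are made in steps 2 and 4, all steps can be carried out (the required normal forms and divisions exist, and the matrix $A$ always stays in $K[t,\sigma]^{m\times m}$), and the algorithm terminates: there is no infinite run, and no run stops before a matrix has been returned. Every matrix $B\in K[t,\sigma]^{m\times m}$ that it returns is equivalent to the input $A$, and the $t$-trailing matrix of $B$ is regular over $K[\sigma]$; equivalently, $\lambda\neq0$ for $B$, i.e. $B$ is $t$-tail regular. -/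

import Mathlib

namespace QTail

open Polynomial

noncomputable section

/-- The endomorphism `p(t) ↦ p(q t)` of `K[t]`. -/
def shiftPoly {K : Type*} [Field K] (q : Kˣ) : K[X] →+* K[X] :=
  (aeval (C (q : K) * X : K[X]) : K[X] →ₐ[K] K[X]).toRingHom

theorem shiftPoly_injective {K : Type*} [Field K] (q : Kˣ) :
    Function.Injective (shiftPoly q) := by
  have h : (shiftPoly q⁻¹).comp (shiftPoly q) = RingHom.id K[X] := by
    ext
    · simp [shiftPoly]
    · simp [shiftPoly, ← mul_assoc, ← C_mul]
  exact Function.LeftInverse.injective (g := shiftPoly q⁻¹) fun p => DFunLike.congr_fun h p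

/-- The `q`-shift `f(t) ↦ f(q t)` on `K(t)`. -/
def shiftRat {K : Type*} [Field K] (q : Kˣ) : RatFunc K →+* RatFunc K :=
  RatFunc.mapRingHom (shiftPoly q)
    (nonZeroDivisors_le_comap_nonZeroDivisors_of_injective _ (shiftPoly_injective q))

/-- A copy of `K[t]`, on which `1 ∈ ℕ` acts by the `q`-shift. -/
def QPoly {K : Type*} [Field K] (_q : Kˣ) : Type _ := K[X]

/-- A copy of `K(t)`, on which `1 ∈ ℕ` acts by the `q`-shift. -/
def QRat {K : Type*} [Field K] (_q : Kˣ) : Type _ := RatFunc K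

instance {K : Type*} [Field K] (q : Kˣ) : CommRing (QPoly q) := inferInstanceAs (CommRing K[X])

instance {K : Type*} [Field K] (q : Kˣ) : Field (QRat q) := inferInstanceAs (Field (RatFunc K))

/-- The identity map from `K[t]` to its copy. -/
def QPoly.of {K : Type*} [Field K] (q : Kˣ) : K[X] ≃+* QPoly q := RingEquiv.refl K[X]

/-- The identity map from `K(t)` to its copy. -/
def QRat.of {K : Type*} [Field K] (q : Kˣ) : RatFunc K ≃+* QRat q := RingEquiv.refl (RatFunc K)

instance {K : Type*} [Field K] (q : Kˣ) : MulSemiringAction (Multiplicative ℕ) (QPoly q) :=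
  MulSemiringAction.compHom (QPoly q) (powersHom (QPoly q →+* QPoly q)
    ((QPoly.of q).toRingHom.comp ((shiftPoly q).comp (QPoly.of q).symm.toRingHom)))

instance {K : Type*} [Field K] (q : Kˣ) : MulSemiringAction (Multiplicative ℕ) (QRat q) :=
  MulSemiringAction.compHom (QRat q) (powersHom (QRat q →+* QRat q)
    ((QRat.of q).toRingHom.comp ((shiftRat q).comp (QRat.of q).symm.toRingHom)))

theorem φ_poly {K : Type*} [Field K] (q : Kˣ) (p : K[X]) :
    SkewPolynomial.φ (QPoly.of q p) = QPoly.of q (shiftPoly q p) := by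
  change ((QPoly.of q).toRingHom.comp ((shiftPoly q).comp (QPoly.of q).symm.toRingHom) ^ 1)
    (QPoly.of q p) = _
  simp

theorem φ_rat {K : Type*} [Field K] (q : Kˣ) (f : RatFunc K) :
    SkewPolynomial.φ (QRat.of q f) = QRat.of q (shiftRat q f) := by
  change ((QRat.of q).toRingHom.comp ((shiftRat q).comp (QRat.of q).symm.toRingHom) ^ 1)
    (QRat.of q f) = _
  simp

/-- The operator ring `K[t,σ]`: polynomials in `σ` with coefficients in `K[t]` on the left and
`σ t = q t σ`. -/
abbrev OpPoly {K : Type*} [Field K] (q : Kˣ) : Type _ := SkewPolynomial (QPoly q)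

/-- The operator ring `K(t)[σ]`. -/
abbrev OpRat {K : Type*} [Field K] (q : Kˣ) : Type _ := SkewPolynomial (QRat q)

/-- The inclusion `K[t] → K(t)`. -/
def coeffEmb {K : Type*} [Field K] (q : Kˣ) : QPoly q →+* QRat q :=
  (QRat.of q).toRingHom.comp ((algebraMap K[X] (RatFunc K)).comp (QPoly.of q).symm.toRingHom)

theorem coeffEmb_φ {K : Type*} [Field K] (q : Kˣ) (p : QPoly q) :
    coeffEmb q (SkewPolynomial.φ p) = SkewPolynomial.φ (coeffEmb q p) := by
  obtain ⟨p, rfl⟩ := (QPoly.of q).surjective p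
  rw [φ_poly]
  change QRat.of q (algebraMap K[X] (RatFunc K) (shiftPoly q p)) =
    SkewPolynomial.φ (QRat.of q (algebraMap K[X] (RatFunc K) p))
  rw [φ_rat]
  congr 1
  rw [shiftRat, RatFunc.coe_mapRingHom_eq_coe_map]
  simpa using (RatFunc.map_apply_div (shiftPoly q)
    (nonZeroDivisors_le_comap_nonZeroDivisors_of_injective _ (shiftPoly_injective q)) p 1).symm

theorem coeffEmb_smul {K : Type*} [Field K] (q : Kˣ) (n : Multiplicative ℕ) (p : QPoly q) :
    coeffEmb q (n • p) = n • coeffEmb q p := by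
  have key : ∀ k : ℕ, coeffEmb q (SkewPolynomial.φ^[k] p) =
      SkewPolynomial.φ^[k] (coeffEmb q p) := by
    intro k
    induction k with
    | zero => rfl
    | succ k ih => rw [Function.iterate_succ_apply', Function.iterate_succ_apply', coeffEmb_φ, ih]
  have := key n.toAdd
  rwa [SkewPolynomial.φ_iterate_apply, SkewPolynomial.φ_iterate_apply] at this

/-- The inclusion of `K[t,σ]` into `K(t)[σ]`: the identity on `σ` and `coeffEmb` on coefficients. -/
def opEmb {K : Type*} [Field K] (q : Kˣ) : OpPoly q →+* OpRat q :=
  SkewMonoidAlgebra.liftNCRingHom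
    ((SkewPolynomial.CRingHom (R := QRat q)).comp (coeffEmb q))
    (powersHom (OpRat q) (SkewPolynomial.X (R := QRat q)))
    (by
      intro x y
      rw [RingHom.comp_apply, RingHom.comp_apply, coeffEmb_smul, powersHom_apply,
        SkewPolynomial.CRingHom_eq_C, SkewPolynomial.CRingHom_eq_C,
        ← SkewPolynomial.monomial_one_right_eq_X_pow, SkewPolynomial.C_mul_monomial,
        SkewPolynomial.monomial_mul_C, SkewPolynomial.φ_iterate_apply, mul_one, one_mul]
      rfl)

/-- The inclusion of `K` into `K[t,σ]`. -/
def constEmb {K : Type*} [Field K] (q : Kˣ) : K →+* OpPoly q :=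
  (SkewPolynomial.CRingHom (R := QPoly q)).comp ((QPoly.of q).toRingHom.comp C)

theorem constEmb_commute {K : Type*} [Field K] (q : Kˣ) (a : K) :
    Commute (constEmb q a) (SkewPolynomial.X (R := QPoly q)) := by
  have h : SkewPolynomial.φ (QPoly.of q (C a)) = QPoly.of q (C a) := by
    rw [φ_poly]
    simp [shiftPoly]
  have h' : constEmb q a = SkewPolynomial.C (QPoly.of q (C a)) := rfl
  change _ * _ = _ * _
  rw [h', ← SkewPolynomial.monomial_one_one_eq_X,
    SkewPolynomial.C_mul_monomial, SkewPolynomial.monomial_mul_C, Function.iterate_one, h,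
    mul_one, one_mul]

/-- The inclusion of `K[σ]`, regarded as the commutative polynomial ring `K[X]` with `X = σ`,
into `K[t,σ]`. -/
def sigmaEmb {K : Type*} [Field K] (q : Kˣ) : K[X] →+* OpPoly q :=
  eval₂RingHom' (constEmb q) (SkewPolynomial.X (R := QPoly q)) (constEmb_commute q)

/-- An operator matrix over `K[t,σ]` is regular if it has full left row rank over `K(t)[σ]`, i.e.
if its rows are left linearly independent over `K(t)[σ]`. -/
def IsRegular {K : Type*} [Field K] {q : Kˣ} {m : ℕ} (A : Matrix (Fin m) (Fin m) (OpPoly q)) :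
    Prop :=
  LinearIndependent (OpRat q) (A.map (opEmb q)).row

/-- `B` is equivalent to `A`: `B = Q A` with `Q` unimodular over `K(t)[σ]`. -/
def IsEquivalent {K : Type*} [Field K] {q : Kˣ} {m : ℕ}
    (A B : Matrix (Fin m) (Fin m) (OpPoly q)) : Prop :=
  ∃ Q : (Matrix (Fin m) (Fin m) (OpRat q))ˣ,
    B.map (opEmb q) = (Q : Matrix (Fin m) (Fin m) (OpRat q)) * A.map (opEmb q)

/-- The part of an operator which is free of `t`: writing `f = ∑ j, f_j(t) σ^j`, this is
`∑ j, f_j(0) σ^j` in `K[σ]`. -/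
def tTrailing {K : Type*} [Field K] {q : Kˣ} (f : OpPoly q) : K[X] :=
  SkewPolynomial.sum f fun j p => monomial j (((QPoly.of q).symm p).coeff 0)

/-- The `t`-trailing matrix of an operator matrix, a matrix over `K[σ]`. -/
def trailingMatrix {K : Type*} [Field K] {q : Kˣ} {m : ℕ}
    (A : Matrix (Fin m) (Fin m) (OpPoly q)) : Matrix (Fin m) (Fin m) K[X] :=
  A.map tTrailing

/-- The order of an operator matrix with respect to `σ` (`0` for the zero matrix). -/
def sigmaOrder {K : Type*} [Field K] {q : Kˣ} {m : ℕ}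
    (A : Matrix (Fin m) (Fin m) (OpPoly q)) : ℕ :=
  Finset.univ.sup fun i => Finset.univ.sup fun j => (SkewPolynomial.support (A i j)).sup id

/-- The constant matrix `A_{j0}` of the coefficients of `t^0 σ^j` in `A`. -/
def constCoeffMatrix {K : Type*} [Field K] {q : Kˣ} {m : ℕ}
    (A : Matrix (Fin m) (Fin m) (OpPoly q)) (j : ℕ) : Matrix (Fin m) (Fin m) K :=
  A.map fun f => ((QPoly.of q).symm (SkewPolynomial.coeff f j)).coeff 0

/-- The polynomial `λ = det (∑ j ≤ s, A_{j0} x^j)`, where `s` is the order of `A`. -/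
def tailPoly {K : Type*} [Field K] {q : Kˣ} {m : ℕ}
    (A : Matrix (Fin m) (Fin m) (OpPoly q)) : K[X] :=
  Matrix.det (∑ j ∈ Finset.range (sigmaOrder A + 1),
    (X ^ j : K[X]) • (constCoeffMatrix A j).map C)

/-- The system with operator matrix `A` is `t`-tail regular. -/
def IsTTailRegular {K : Type*} [Field K] {q : Kˣ} {m : ℕ}
    (A : Matrix (Fin m) (Fin m) (OpPoly q)) : Prop :=
  tailPoly A ≠ 0

/-! ### Gröbner bases of row modules over `K[σ]`

The monomial `e_i σ^a` of `K[σ]^m` is represented by the pair `(i, a)`. -/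

/-- The term over position ordering: `e_i σ^a ≤ e_j σ^b` iff `a < b`, or `a = b` and `i ≥ j`. -/
def TopLE {m : ℕ} (u w : Fin m × ℕ) : Prop :=
  u.2 < w.2 ∨ (u.2 = w.2 ∧ w.1 ≤ u.1)

/-- The monomial `u` divides the monomial `w`. -/
def MonomialDvd {m : ℕ} (u w : Fin m × ℕ) : Prop :=
  u.1 = w.1 ∧ u.2 ≤ w.2

/-- The coefficient of the monomial `u` in the row vector `v`. -/
def vcoeff {K : Type*} [Field K] {m : ℕ} (v : Fin m → K[X]) (u : Fin m × ℕ) : K :=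
  (v u.1).coeff u.2

/-- `u` is the leading monomial of `v` (in particular, `v` is not zero). -/
def IsLeading {K : Type*} [Field K] {m : ℕ} (v : Fin m → K[X]) (u : Fin m × ℕ) : Prop :=
  vcoeff v u ≠ 0 ∧ ∀ w, vcoeff v w ≠ 0 → TopLE w u

/-- Popov normal form: the rows of `P` are a minimal Gröbner basis (of the module they generate)
for the term over position ordering. -/
structure IsPopov {K : Type*} [Field K] {ι : Type*} {m : ℕ} (P : Matrix ι (Fin m) K[X]) :
    Prop where
  /-- The rows are nonzero with leading coefficient `1`. -/
  monic : ∀ i, ∃ u, IsLeading (P.row i) u ∧ vcoeff (P.row i) u = 1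
  /-- The leading monomial of every nonzero element of the row module is divisible by the leading
  monomial of a row. -/
  groebner : ∀ f ∈ Submodule.span K[X] (Set.range P.row), f ≠ 0 →
    ∃ i u w, IsLeading (P.row i) u ∧ IsLeading f w ∧ MonomialDvd u w
  /-- No leading monomial of a row divides that of another row. -/
  minimal : ∀ i j u w, i ≠ j → IsLeading (P.row i) u → IsLeading (P.row j) w →
    ¬ MonomialDvd u w

/-- No row of `Y` is reducible by `P`: no monomial occurring in a row of `Y` is divisible by the
leading monomial of a row of `P`. -/
def IsReducedBy {K : Type*} [Field K] {ι κ : Type*} {m : ℕ} (P : Matrix ι (Fin m) K[X])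
    (Y : Matrix κ (Fin m) K[X]) : Prop :=
  ∀ k i u w, IsLeading (P.row i) u → vcoeff (Y.row k) w ≠ 0 → ¬ MonomialDvd u w

/-! ### The algorithm -/

/-- The first `r` rows of a matrix. -/
def upperRows {R : Type*} {m : ℕ} (r : ℕ) (M : Matrix (Fin m) (Fin m) R) :
    Matrix {i : Fin m // (i : ℕ) < r} (Fin m) R :=
  M.submatrix Subtype.val id

/-- The last `m - r` rows of a matrix. -/
def lowerRows {R : Type*} {m : ℕ} (r : ℕ) (M : Matrix (Fin m) (Fin m) R) :
    Matrix {i : Fin m // ¬ (i : ℕ) < r} (Fin m) R :=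
  M.submatrix Subtype.val id

/-- The matrix `T = diag(1_r, t⁻¹ 1_{m-r})` over `K(t)[σ]`. -/
def shiftMatrix {K : Type*} [Field K] (q : Kˣ) (m r : ℕ) : Matrix (Fin m) (Fin m) (OpRat q) :=
  Matrix.diagonal fun i =>
    if (i : ℕ) < r then 1
    else SkewPolynomial.C (QRat.of q (RatFunc.X : RatFunc K)⁻¹)

/-- The block matrix with rows `(1_r, 0)` and `(-X, 1_{m-r})`. -/
def reductionMatrix {R : Type*} [CommRing R] {m : ℕ} (r : ℕ)
    (X : Matrix {i : Fin m // ¬ (i : ℕ) < r} {i : Fin m // (i : ℕ) < r} R) :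
    Matrix (Fin m) (Fin m) R :=
  (Matrix.fromBlocks 1 0 (-X) 1).reindex (Equiv.sumCompl fun i : Fin m => (i : ℕ) < r)
    (Equiv.sumCompl fun i : Fin m => (i : ℕ) < r)

/-- The configurations of the algorithm; each carries the current value of `A`. -/
inductive State {K : Type*} [Field K] (q : Kˣ) (m : ℕ) : Type _
  /-- At the head of the outer loop. -/
  | outer (A : Matrix (Fin m) (Fin m) (OpPoly q))
  /-- At the head of the inner loop, about to multiply the lower rows by `t⁻¹`. -/
  | inner (r : ℕ) (A : Matrix (Fin m) (Fin m) (OpPoly q))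
  /-- Inside the inner loop, about to reduce the lower rows of the `t`-trailing matrix. -/
  | reduce (r : ℕ) (A : Matrix (Fin m) (Fin m) (OpPoly q))
  /-- The algorithm has stopped and returned `B`. -/
  | returned (B : Matrix (Fin m) (Fin m) (OpPoly q))

/-- One step of the algorithm. A configuration may have several successors, since neither the Popov
normal form nor the transformation matrix leading to it is unique. -/
inductive Step {K : Type*} [Field K] {q : Kˣ} {m : ℕ} : State q m → State q m → Prop
  /-- If the `t`-trailing matrix has nonzero determinant, return `A`. -/
  | ret (A : Matrix (Fin m) (Fin m) (OpPoly q)) (hdet : (trailingMatrix A).det ≠ 0) :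
      Step (.outer A) (.returned A)
  /-- Otherwise bring the `t`-trailing matrix into Popov normal form, with `r` nonzero rows, by a
  unimodular `X` over `K[σ]`, and multiply `A` by `X`. -/
  | popov (A : Matrix (Fin m) (Fin m) (OpPoly q)) (hdet : (trailingMatrix A).det = 0)
      (X : (Matrix (Fin m) (Fin m) K[X])ˣ) (r : ℕ) (hr : r ≤ m)
      (hP : IsPopov (upperRows r ((X : Matrix (Fin m) (Fin m) K[X]) * trailingMatrix A)))
      (hzero : lowerRows r ((X : Matrix (Fin m) (Fin m) K[X]) * trailingMatrix A) = 0) :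
      Step (.outer A) (.inner r ((X : Matrix (Fin m) (Fin m) K[X]).map (sigmaEmb q) * A))
  /-- Multiply the lower rows of `A` by `t⁻¹`; the result `A'` must again lie over `K[t,σ]`. -/
  | shift (r : ℕ) (A A' : Matrix (Fin m) (Fin m) (OpPoly q))
      (hA' : A'.map (opEmb q) = shiftMatrix q m r * A.map (opEmb q)) :
      Step (.inner r A) (.reduce r A')
  /-- Division `C₀ = X B₀ + Y` of the lower rows of the `t`-trailing matrix by the upper ones;
  if `Y = 0`, continue with the inner loop. -/
  | continueInner (r : ℕ) (A : Matrix (Fin m) (Fin m) (OpPoly q))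
      (X : Matrix {i : Fin m // ¬ (i : ℕ) < r} {i : Fin m // (i : ℕ) < r} K[X])
      (Y : Matrix {i : Fin m // ¬ (i : ℕ) < r} (Fin m) K[X])
      (hdiv : lowerRows r (trailingMatrix A) = X * upperRows r (trailingMatrix A) + Y)
      (hred : IsReducedBy (upperRows r (trailingMatrix A)) Y) (hY : Y = 0) :
      Step (.reduce r A) (.inner r ((reductionMatrix r X).map (sigmaEmb q) * A))
  /-- The same division; if `Y ≠ 0`, go back to the outer loop. -/
  | backToOuter (r : ℕ) (A : Matrix (Fin m) (Fin m) (OpPoly q))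
      (X : Matrix {i : Fin m // ¬ (i : ℕ) < r} {i : Fin m // (i : ℕ) < r} K[X])
      (Y : Matrix {i : Fin m // ¬ (i : ℕ) < r} (Fin m) K[X])
      (hdiv : lowerRows r (trailingMatrix A) = X * upperRows r (trailingMatrix A) + Y)
      (hred : IsReducedBy (upperRows r (trailingMatrix A)) Y) (hY : Y ≠ 0) :
      Step (.reduce r A) (.outer ((reductionMatrix r X).map (sigmaEmb q) * A))

/-- `s'` can be reached from `s` by finitely many steps of the algorithm. -/
def Reaches {K : Type*} [Field K] {q : Kˣ} {m : ℕ} (s s' : State q m) : Prop :=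
  Relation.ReflTransGen Step s s'

end

end QTail

/-!
# Termination and correctness of the algorithm

Setting `t = 0` is a ring homomorphism `K[t,σ] → K[σ]` (`trailingHom`), since the two-sided ideal
generated by `t` is just `t K[t,σ]`. Hence every transformation over `K[σ]` acts on the
trailing matrix as it does on `A`, and an operator whose trailing part vanishes can be divided by
`t` on the left (`exists_tOp_mul_eq`), which is what makes the multiplication by `T` possible.

*The outer loop terminates* (`acc_outer`). The transformation to Popov normal form does not change
the row module of the trailing matrix, and the inner loop keeps the upper rows `B₀`. The loop is
left only with additional nonzero rows `Y` that are reduced with respect to the Gröbner basis `B₀`,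
and so do not lie in its row module. Thus the row module grows strictly, which can happen only
finitely often since `K[σ]^m` is Noetherian.

*The inner loop terminates* (`acc_inner`). As the trailing matrix is singular, there are fewer than
`m` upper rows `U`, and `U g = 0` for some nonzero vector `g` over `K[t,σ]`. Since `A` is regular,
`A g ≠ 0`, so some entry `h` of `A g` in the lower rows is nonzero. Reducing the lower rows by the
upper ones does not affect `h`, whereas each multiplication by `T` divides it by `t`; so the number
of iterations is at most the degree in `t` of any nonzero coefficient of `h`.

The existence of `g`, and the fact that regular matrices have no right null vectors, both rest on
the strong rank condition for `K[t,σ]` and for its opposite ring, which follows from a comparison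
of dimensions (`strongRankCondition_of_basis`): the monomials `t^i σ^j` form a `K`-basis that is
multiplicative up to scalars.

*The normal forms exist.* Each submodule of `K[σ]^m` has a minimal Gröbner basis with at most one
element for each position (`exists_isPopov_span_eq`); it is linearly independent, hence a basis of
the row module. Lifting this basis along `c ↦ c M` and completing it by a basis of the kernel gives
a unimodular transformation (`exists_unit_isPopov`).
-/

namespace QTail

/-! ### The strong rank condition for algebras of quadratic growth -/

section Growth

open Module

/-- Multiplication adds the bounds on the exponents. -/
theorem mul_mem_span_basis_Iic {K R : Type*} [Field K] [Ring R] [Algebra K R]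
    (b : Basis (ℕ × ℕ) K R) (hmul : ∀ u w, ∃ c : K, b u * b w = c • b (u + w)) (M N : ℕ) {x y : R}
    (hx : x ∈ Submodule.span K (b '' Set.Iic (M, M)))
    (hy : y ∈ Submodule.span K (b '' Set.Iic (N, N))) :
    x * y ∈ Submodule.span K (b '' Set.Iic (M + N, M + N)) := by
  have h := Submodule.mul_mem_mul hx hy
  rw [Submodule.span_mul_span] at h
  refine Submodule.span_le.2 ?_ h
  rintro _ ⟨_, ⟨u, hu, rfl⟩, _, ⟨w, hw, rfl⟩, rfl⟩
  obtain ⟨c, hc⟩ := hmul u w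
  refine SetLike.mem_coe.2 ?_
  change b u * b w ∈ _
  rw [hc]
  refine Submodule.smul_mem _ _ (Submodule.subset_span ⟨u + w, ?_, rfl⟩)
  exact Set.mem_Iic.2 (add_le_add (Set.mem_Iic.1 hu) (Set.mem_Iic.1 hw) : u + w ≤ (M, M) + (N, N))

theorem finrank_span_basis_Iic {K R : Type*} [Field K] [AddCommGroup R] [Module K R]
    (b : Basis (ℕ × ℕ) K R) (N : ℕ) :
    finrank K (Submodule.span K (b '' Set.Iic (N, N))) = (N + 1) ^ 2 := by
  have h := finrank_span_eq_card (b.linearIndependent.comp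
    (fun u : Finset.Iic (N, N) => (u : ℕ × ℕ)) Subtype.val_injective)
  rw [Set.range_comp, Subtype.range_coe_subtype, Fintype.card_coe] at h
  have hc : (Finset.Iic (N, N)).card = (N + 1) ^ 2 := by
    rw [← Finset.Iic_product_Iic, Finset.card_product, Nat.card_Iic, sq]
  have hs : {u | u ∈ Finset.Iic (N, N)} = Set.Iic (N, N) := by
    ext
    simp
  rw [← hc, ← h, hs]

theorem mem_span_basis_Iic {K R : Type*} [Field K] [AddCommGroup R] [Module K R]
    (b : Basis (ℕ × ℕ) K R) (x : R) :
    ∃ N₀, ∀ N ≥ N₀, x ∈ Submodule.span K (b '' Set.Iic (N, N)) := by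
  refine ⟨(b.repr x).support.sup fun u => max u.1 u.2, fun N hN => ?_⟩
  rw [b.mem_span_image]
  intro u hu
  have := (Finset.le_sup (f := fun u : ℕ × ℕ => max u.1 u.2) hu).trans hN
  exact Set.mem_Iic.2 (Prod.mk_le_mk.2
    ⟨(le_max_left _ _).trans this, (le_max_right _ _).trans this⟩)

/-- An algebra over a field with a basis indexed by `ℕ × ℕ` that is multiplicative up to scalars
satisfies the strong rank condition: the elements with exponents at most `N` form a space of
dimension `(N + 1) ^ 2`, multiplication by a fixed element raises `N` by a constant, and
`(m + 1) (N + 1) ^ 2` outgrows `m (N + c + 1) ^ 2`. -/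
theorem strongRankCondition_of_basis {K R : Type*} [Field K] [Ring R] [Algebra K R]
    (b : Basis (ℕ × ℕ) K R) (hmul : ∀ u w, ∃ c : K, b u * b w = c • b (u + w)) :
    StrongRankCondition R := by
  rw [strongRankCondition_iff_succ]
  intro m f hf
  choose c hc using fun p : Fin (m + 1) × Fin m => mem_span_basis_Iic b (f (Pi.single p.1 1) p.2)
  set d := Finset.univ.sup c
  have hd : ∀ i j, f (Pi.single i 1) j ∈ Submodule.span K (b '' Set.Iic (d, d)) := fun i j =>
    hc (i, j) d (Finset.le_sup (Finset.mem_univ (i, j)))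
  have hfx : ∀ x j, f x j = ∑ i, x i * f (Pi.single i 1) j := by
    intro x j
    conv_lhs => rw [pi_eq_sum_univ' x]
    simp
  let V : ℕ → Submodule K R := fun N => Submodule.span K (b '' Set.Iic (N, N))
  have hV : ∀ N, finrank K (V N) = (N + 1) ^ 2 := finrank_span_basis_Iic b
  have : ∀ N, FiniteDimensional K (V N) := fun N => by
    apply FiniteDimensional.of_finrank_pos
    rw [hV]
    positivity
  have key : ∀ N, (m + 1) * (N + 1) ^ 2 ≤ m * (N + d + 1) ^ 2 := by
    intro N
    let g : (Fin (m + 1) → V N) →ₗ[K] (Fin m → V (N + d)) :=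
      LinearMap.pi fun j => LinearMap.codRestrict (V (N + d))
        ((LinearMap.proj j).comp ((f.restrictScalars K).comp
          (LinearMap.pi fun i => (V N).subtype.comp (LinearMap.proj i)))) (by
            intro x
            simp only [LinearMap.comp_apply, LinearMap.proj_apply, LinearMap.restrictScalars_apply]
            rw [hfx]
            exact Submodule.sum_mem _ fun i _ =>
              mul_mem_span_basis_Iic b hmul _ _ (x i).2 (hd i j))
    have hg : Function.Injective g := by
      intro x y hxy
      have : (fun i => (x i : R)) = fun i => (y i : R) := by
        apply hf
        ext j
        exact congrArg (fun z => ((z j : V (N + d)) : R)) hxy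
      ext i
      exact congrFun this i
    have := LinearMap.finrank_le_finrank_of_injective hg
    simpa [finrank_pi_fintype, hV] using this
  -- For `M = m (2 d + d ^ 2) + 1`, the inequality `(m + 1) M ^ 2 ≤ m (M + d) ^ 2` would give
  -- `M ^ 2 ≤ m (2 d M + d ^ 2) ≤ (M - 1) M`.
  have h := key (m * (2 * d + d ^ 2))
  rw [add_right_comm] at h
  set M := m * (2 * d + d ^ 2) + 1 with hM
  have h1 : M * M ≤ 2 * m * d * M + m * d ^ 2 * 1 := by linarith
  have h2 : m * d ^ 2 * 1 ≤ m * d ^ 2 * M := Nat.mul_le_mul_left _ (by omega)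
  have h3 : M * M = (2 * m * d + m * d ^ 2 + 1) * M := by
    congr 1
    rw [hM]
    ring
  have h4 : 0 < M := by omega
  linarith

end Growth

open Polynomial

noncomputable section

/-! ### The operator rings -/

/-- The `n`-fold `q`-shift multiplies the coefficient of `t^i` by `q^(n i)`; in particular it
preserves constant coefficients, which is why `t`-trailing parts are multiplicative. -/
theorem coeff_iterate_φ {K : Type*} [Field K] (q : Kˣ) (p : K[X]) (n i : ℕ) :
    ((QPoly.of q).symm (SkewPolynomial.φ^[n] (QPoly.of q p))).coeff i =
      (q : K) ^ (n * i) * p.coeff i := by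
  induction n generalizing p with
  | zero => simp
  | succ n ih =>
    have h : (shiftPoly q p).coeff i = (q : K) ^ i * p.coeff i := by
      change (aeval (C (q : K) * X : K[X]) p).coeff i = _
      rw [← comp_eq_aeval, comp_C_mul_X_coeff, mul_comm]
    rw [Function.iterate_succ_apply, φ_poly, ih, h]
    ring

instance {K : Type*} [Field K] (q : Kˣ) : Algebra K (QPoly q) := inferInstanceAs (Algebra K K[X])

theorem QPoly.of_smul {K : Type*} [Field K] (q : Kˣ) (a : K) (p : K[X]) :
    QPoly.of q (a • p) = a • QPoly.of q p := rfl

instance {K : Type*} [Field K] (q : Kˣ) : SMulCommClass (Multiplicative ℕ) K (QPoly q) where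
  smul_comm n a p := by
    obtain ⟨p, rfl⟩ := (QPoly.of q).surjective p
    rw [← ofAdd_toAdd n, ← SkewPolynomial.φ_iterate_apply, ← SkewPolynomial.φ_iterate_apply,
      ← QPoly.of_smul]
    apply (QPoly.of q).symm.injective
    ext i
    rw [coeff_iterate_φ, coeff_smul, smul_eq_mul, mul_left_comm, ← coeff_iterate_φ]
    exact (coeff_smul a ((QPoly.of q).symm _) i).symm

/-- The identity map from `K[t]` to its copy, as a `K`-linear equivalence. -/
def QPoly.ofLinear {K : Type*} [Field K] (q : Kˣ) : K[X] ≃ₗ[K] QPoly q :=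
  { (QPoly.of q).toAddEquiv with map_smul' := fun _ _ => rfl }

/-- The basis of `K[t,σ]` over `K` formed by the monomials `t^i σ^j`. -/
def monomialBasis {K : Type*} [Field K] (q : Kˣ) : Module.Basis (ℕ × ℕ) K (OpPoly q) :=
  (((Polynomial.basisMonomials K).map (QPoly.ofLinear q)).smulTower
    (SkewMonoidAlgebra.basisSingleOne (k := QPoly q) (G := Multiplicative ℕ))).reindex
    ((Equiv.refl ℕ).prodCongr Multiplicative.toAdd)

theorem monomialBasis_apply {K : Type*} [Field K] (q : Kˣ) (u : ℕ × ℕ) :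
    monomialBasis q u = SkewPolynomial.monomial u.2 (QPoly.of q (monomial u.1 1)) := by
  rw [monomialBasis, Module.Basis.reindex_apply, Module.Basis.smulTower_apply,
    Module.Basis.map_apply, coe_basisMonomials]
  change QPoly.of q (monomial u.1 1) • SkewPolynomial.monomial u.2 1 = _
  rw [SkewPolynomial.smul_monomial, smul_eq_mul, mul_one]

theorem monomialBasis_mul {K : Type*} [Field K] (q : Kˣ) (u w : ℕ × ℕ) :
    ∃ c : K, monomialBasis q u * monomialBasis q w = c • monomialBasis q (u + w) := by
  refine ⟨(q : K) ^ (u.2 * w.1), ?_⟩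
  simp only [monomialBasis_apply, SkewPolynomial.monomial_mul_monomial,
    SkewPolynomial.smul_monomial, Prod.fst_add, Prod.snd_add]
  congr 1
  rw [← QPoly.of_smul]
  apply (QPoly.of q).symm.injective
  ext i
  simp only [map_mul, RingEquiv.symm_apply_apply, coeff_smul, smul_eq_mul]
  have h : (QPoly.of q).symm (SkewPolynomial.φ^[u.2] (QPoly.of q (monomial w.1 1))) =
      C ((q : K) ^ (u.2 * w.1)) * monomial w.1 1 := by
    ext k
    rw [coeff_iterate_φ, coeff_C_mul, coeff_monomial]
    split_ifs with hk
    · rw [hk]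
    · simp
  rw [h, mul_left_comm, monomial_mul_monomial, coeff_C_mul, mul_one]

instance {K : Type*} [Field K] (q : Kˣ) : StrongRankCondition (OpPoly q) :=
  strongRankCondition_of_basis (monomialBasis q) (monomialBasis_mul q)

instance {K : Type*} [Field K] (q : Kˣ) : StrongRankCondition (OpPoly q)ᵐᵒᵖ := by
  refine strongRankCondition_of_basis (K := K)
    ((monomialBasis q).map (MulOpposite.opLinearEquiv K)) fun u w => ?_
  obtain ⟨c, hc⟩ := monomialBasis_mul q w u
  refine ⟨c, ?_⟩
  simp only [Module.Basis.map_apply, MulOpposite.coe_opLinearEquiv]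
  rw [← MulOpposite.op_mul, hc, add_comm u w, MulOpposite.op_smul]

/-! ### The trailing part -/

theorem coeff_tTrailing {K : Type*} [Field K] {q : Kˣ} (f : OpPoly q) (j : ℕ) :
    (tTrailing f).coeff j = ((QPoly.of q).symm (SkewPolynomial.coeff f j)).coeff 0 := by
  rw [tTrailing, SkewPolynomial.sum_def, finsetSum_coeff]
  simp only [coeff_monomial]
  rw [Finset.sum_ite_eq']
  split_ifs with h
  · rfl
  · rw [SkewPolynomial.mem_support_iff, not_not] at h
    rw [h, map_zero, coeff_zero]

theorem tTrailing_add {K : Type*} [Field K] {q : Kˣ} (f g : OpPoly q) :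
    tTrailing (f + g) = tTrailing f + tTrailing g := by
  ext j
  simp [coeff_tTrailing]

theorem tTrailing_monomial {K : Type*} [Field K] {q : Kˣ} (j : ℕ) (p : QPoly q) :
    tTrailing (SkewPolynomial.monomial j p) = monomial j (((QPoly.of q).symm p).coeff 0) := by
  rw [tTrailing, SkewPolynomial.sum_monomial_index]
  simp

theorem tTrailing_mul {K : Type*} [Field K] {q : Kˣ} (f g : OpPoly q) :
    tTrailing (f * g) = tTrailing f * tTrailing g := by
  have h0 : tTrailing (0 : OpPoly q) = 0 := by
    ext j
    simp [coeff_tTrailing]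
  induction f using SkewPolynomial.induction with
  | h0 => simp [h0]
  | ha n r f _ _ hf =>
    rw [add_mul, tTrailing_add, tTrailing_add, hf, add_mul]
    congr 1
    clear hf
    induction g using SkewPolynomial.induction with
    | h0 => simp [h0]
    | ha k s g _ _ hg =>
      rw [mul_add, tTrailing_add, tTrailing_add, hg, mul_add]
      congr 1
      obtain ⟨s, rfl⟩ := (QPoly.of q).surjective s
      simp only [SkewPolynomial.monomial_mul_monomial, tTrailing_monomial, monomial_mul_monomial,
        map_mul, mul_coeff_zero, coeff_iterate_φ]
      simp

/-- Taking the `t`-trailing part is a ring homomorphism `K[t,σ] → K[σ]`, the reduction modulo the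
two-sided ideal generated by `t`. -/
def trailingHom {K : Type*} [Field K] (q : Kˣ) : OpPoly q →+* K[X] where
  toFun := tTrailing
  map_zero' := by
    ext j
    simp [coeff_tTrailing]
  map_one' := by
    rw [← SkewPolynomial.monomial_zero_one, tTrailing_monomial]
    simp
  map_add' := tTrailing_add
  map_mul' := tTrailing_mul

theorem trailingMatrix_eq_map {K : Type*} [Field K] {q : Kˣ} {m : ℕ}
    (A : Matrix (Fin m) (Fin m) (OpPoly q)) : trailingMatrix A = A.map (trailingHom q) := rfl

theorem trailingHom_sigmaEmb {K : Type*} [Field K] (q : Kˣ) (p : K[X]) :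
    trailingHom q (sigmaEmb q p) = p := by
  have : (trailingHom q).comp (sigmaEmb q) = RingHom.id K[X] := by
    apply Polynomial.ringHom_ext
    · intro a
      rw [RingHom.comp_apply, sigmaEmb, eval₂RingHom'_apply, eval₂_C]
      change tTrailing (SkewPolynomial.monomial 0 (QPoly.of q (C a))) = C a
      rw [tTrailing_monomial]
      simp
    · rw [RingHom.comp_apply, sigmaEmb, eval₂RingHom'_apply, eval₂_X]
      change tTrailing (SkewPolynomial.monomial 1 1) = X
      rw [tTrailing_monomial]
      simp [Polynomial.X]
  exact DFunLike.congr_fun this p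

/-- The element `t` of `K[t,σ]`. -/
def tOp {K : Type*} [Field K] (q : Kˣ) : OpPoly q := SkewPolynomial.C (QPoly.of q X)

theorem _root_.SkewPolynomial.coeff_C_mul {R : Type*} [Semiring R]
    [MulSemiringAction (Multiplicative ℕ) R] (a : R) (f : SkewPolynomial R) (j : ℕ) :
    SkewPolynomial.coeff (SkewPolynomial.C a * f) j = a * SkewPolynomial.coeff f j :=
  SkewMonoidAlgebra.coeff_single_one_mul f a (Multiplicative.ofAdd j)

theorem exists_tOp_mul_eq {K : Type*} [Field K] {q : Kˣ} {f : OpPoly q} (hf : tTrailing f = 0) :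
    ∃ g, tOp q * g = f := by
  refine ⟨SkewPolynomial.sum f fun j p =>
    SkewPolynomial.monomial j (QPoly.of q ((QPoly.of q).symm p).divX), ?_⟩
  rw [SkewPolynomial.sum_def, Finset.mul_sum]
  conv_rhs => rw [← SkewPolynomial.sum_monomial f, SkewPolynomial.sum_def]
  refine Finset.sum_congr rfl fun j _ => ?_
  rw [tOp, SkewPolynomial.C_mul_monomial, ← map_mul]
  congr 1
  apply (QPoly.of q).symm.injective
  have h := X_mul_divX_add ((QPoly.of q).symm (SkewPolynomial.coeff f j))
  rw [← coeff_tTrailing, hf] at h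
  simpa using h

theorem opEmb_monomial {K : Type*} [Field K] (q : Kˣ) (j : ℕ) (p : QPoly q) :
    opEmb q (SkewPolynomial.monomial j p) = SkewPolynomial.monomial j (coeffEmb q p) := by
  change SkewMonoidAlgebra.liftNC _ _ (SkewMonoidAlgebra.single _ _) = _
  rw [SkewMonoidAlgebra.liftNC_single]
  change SkewPolynomial.C (coeffEmb q p) * (SkewPolynomial.X ^ j) = _
  rw [← SkewPolynomial.monomial_one_right_eq_X_pow, SkewPolynomial.C_mul_monomial, mul_one]

theorem coeff_opEmb {K : Type*} [Field K] (q : Kˣ) (f : OpPoly q) (j : ℕ) :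
    SkewPolynomial.coeff (opEmb q f) j = coeffEmb q (SkewPolynomial.coeff f j) := by
  induction f using SkewPolynomial.induction with
  | h0 => simp
  | ha n r f _ _ hf =>
    rw [map_add, SkewPolynomial.coeff_add, hf, opEmb_monomial, SkewPolynomial.coeff_add, map_add]
    simp only [SkewPolynomial.coeff_monomial, apply_ite (coeffEmb q), map_zero]

theorem opEmb_injective {K : Type*} [Field K] (q : Kˣ) : Function.Injective (opEmb q) := by
  intro f g h
  refine SkewMonoidAlgebra.ext fun j => IsFractionRing.injective K[X] (RatFunc K) ?_
  have hj := congrArg (fun x => SkewPolynomial.coeff x j.toAdd) h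
  simp only [coeff_opEmb] at hj
  exact hj

theorem opEmb_tOp {K : Type*} [Field K] (q : Kˣ) :
    opEmb q (tOp q) = SkewPolynomial.C (QRat.of q RatFunc.X) := by
  rw [tOp, ← SkewPolynomial.monomial_zero_left, opEmb_monomial, ← RatFunc.algebraMap_X]
  rfl

/-! ### Leading monomials and division over `K[σ]` -/

/-- The position of the monomial `u` in the term over position ordering, which has order type
`ω`. -/
def topRank {m : ℕ} (u : Fin m × ℕ) : ℕ := u.2 * m + u.1.rev

theorem topLE_iff {m : ℕ} {u w : Fin m × ℕ} : TopLE u w ↔ topRank u ≤ topRank w := by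
  obtain ⟨i, a⟩ := u
  obtain ⟨j, b⟩ := w
  have hlt : ∀ (i j : Fin m) (a b : ℕ), a < b → topRank (i, a) < topRank (j, b) := by
    intro i j a b h
    have h1 : (a + 1) * m ≤ b * m := Nat.mul_le_mul_right m h
    have h2 := i.rev.isLt
    simp only [topRank]
    rw [Nat.succ_mul] at h1
    omega
  rcases lt_trichotomy a b with h | rfl | h
  · exact ⟨fun _ => (hlt i j a b h).le, fun _ => Or.inl h⟩
  · simp only [TopLE, topRank, lt_irrefl, true_and, false_or, add_le_add_iff_left, Fin.val_fin_le,
      Fin.rev_le_rev]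
  · have := hlt j i b a h
    simp only [TopLE]
    omega

theorem topRank_injective {m : ℕ} : Function.Injective (topRank : Fin m × ℕ → ℕ) := by
  rintro ⟨i, a⟩ ⟨j, b⟩ h
  have h1 := topLE_iff.2 h.le
  have h2 := topLE_iff.2 h.ge
  simp only [TopLE] at h1 h2
  ext <;> simp only [] <;> omega

theorem vcoeff_ext {K : Type*} [Field K] {m : ℕ} {v w : Fin m → K[X]}
    (h : ∀ u, vcoeff v u = vcoeff w u) : v = w := by
  funext i
  ext a
  exact h (i, a)

theorem vcoeff_sub {K : Type*} [Field K] {m : ℕ} (v w : Fin m → K[X]) (u : Fin m × ℕ) :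
    vcoeff (v - w) u = vcoeff v u - vcoeff w u := by
  simp [vcoeff]

theorem vcoeff_single {K : Type*} [Field K] {m : ℕ} (u w : Fin m × ℕ) (a : K) :
    vcoeff (Pi.single u.1 (monomial u.2 a)) w = if w = u then a else 0 := by
  obtain ⟨i, k⟩ := u
  obtain ⟨j, l⟩ := w
  by_cases h : j = i
  · subst h
    simp [vcoeff, coeff_monomial, eq_comm]
  · simp [vcoeff, h]

theorem exists_isLeading {K : Type*} [Field K] {m : ℕ} {v : Fin m → K[X]} (hv : v ≠ 0) :
    ∃ u, IsLeading v u := by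
  classical
  let s : Finset (Fin m × ℕ) := Finset.univ.biUnion fun i => (v i).support.image (Prod.mk i)
  have hs : ∀ u, u ∈ s ↔ vcoeff v u ≠ 0 := by
    rintro ⟨i, a⟩
    simp [s, vcoeff]
  have hne : s.Nonempty := by
    by_contra h
    rw [Finset.not_nonempty_iff_eq_empty] at h
    refine hv (vcoeff_ext fun u => ?_)
    by_contra hu
    have := (hs u).2 (by simpa [vcoeff] using hu)
    simp [h] at this
  obtain ⟨u, hu, hmax⟩ := s.exists_max_image topRank hne
  exact ⟨u, (hs u).1 hu, fun w hw => topLE_iff.2 (hmax w ((hs w).2 hw))⟩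

theorem IsLeading.unique {K : Type*} [Field K] {m : ℕ} {v : Fin m → K[X]} {u w : Fin m × ℕ}
    (hu : IsLeading v u) (hw : IsLeading v w) : u = w :=
  topRank_injective (le_antisymm (topLE_iff.1 (hw.2 u hu.1)) (topLE_iff.1 (hu.2 w hw.1)))

theorem IsLeading.vcoeff_smul {K : Type*} [Field K] {m : ℕ} {v : Fin m → K[X]} {u : Fin m × ℕ}
    (hu : IsLeading v u) (c : K[X]) :
    vcoeff (c • v) (u.1, c.natDegree + u.2) = c.leadingCoeff * vcoeff v u := by
  have hdeg : (v u.1).natDegree ≤ u.2 := by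
    rw [natDegree_le_iff_coeff_eq_zero]
    intro a ha
    by_contra h
    rcases hu.2 (u.1, a) h with h' | h' <;> simp at h' <;> omega
  simp only [vcoeff, Pi.smul_apply, smul_eq_mul]
  rw [coeff_mul_add_eq_of_natDegree_le le_rfl hdeg, leadingCoeff]

theorem IsLeading.topLE_smul {K : Type*} [Field K] {m : ℕ} {v : Fin m → K[X]} {u w : Fin m × ℕ}
    (hu : IsLeading v u) {c : K[X]} (hw : vcoeff (c • v) w ≠ 0) :
    TopLE w (u.1, c.natDegree + u.2) := by
  simp only [vcoeff, Pi.smul_apply, smul_eq_mul] at hw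
  rw [coeff_mul] at hw
  obtain ⟨⟨a, b⟩, hab, hne⟩ := Finset.exists_ne_zero_of_sum_ne_zero hw
  rw [Finset.HasAntidiagonal.mem_antidiagonal] at hab
  have ha := le_natDegree_of_ne_zero (left_ne_zero_of_mul hne)
  have hb := hu.2 (w.1, b) (right_ne_zero_of_mul hne)
  simp only [TopLE] at hb hab ha ⊢
  omega

/-- Vectors whose leading monomials sit at pairwise distinct positions are linearly independent:
the leading terms of the summands of a linear combination cannot cancel. -/
theorem linearIndependent_of_isLeading {K : Type*} [Field K] {ι : Type*} {m : ℕ}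
    {P : ι → Fin m → K[X]} {u : ι → Fin m × ℕ} (hu : ∀ i, IsLeading (P i) (u i))
    (hinj : Function.Injective fun i => (u i).1) : LinearIndependent K[X] P := by
  classical
  rw [linearIndependent_iff']
  intro s g hg
  by_contra! hne
  obtain ⟨i₀, hi₀, hi₀'⟩ := hne
  obtain ⟨i, hi, hmax⟩ := (s.filter fun i => g i ≠ 0).exists_max_image
    (fun i => topRank ((u i).1, (g i).natDegree + (u i).2)) ⟨i₀, by simp [hi₀, hi₀']⟩
  rw [Finset.mem_filter] at hi
  set w : Fin m × ℕ := ((u i).1, (g i).natDegree + (u i).2) with hw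
  have hsum : ∑ j ∈ s, vcoeff (g j • P j) w = 0 := by
    have := congrArg (fun v => vcoeff v w) hg
    simpa [vcoeff, finsetSum_coeff] using this
  rw [Finset.sum_eq_single_of_mem i hi.1] at hsum
  · rw [hw, (hu i).vcoeff_smul] at hsum
    exact mul_ne_zero (leadingCoeff_ne_zero.2 hi.2) (hu i).1 hsum
  · intro j hj hji
    by_contra hne
    have hgj : g j ≠ 0 := by
      intro h
      simp [h, vcoeff] at hne
    have h1 := topLE_iff.1 ((hu j).topLE_smul hne)
    have h2 := hmax j (Finset.mem_filter.2 ⟨hj, hgj⟩)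
    have h3 := topRank_injective (le_antisymm h1 h2)
    exact hji (hinj (congrArg Prod.fst h3).symm)

/-- Division with remainder by a family of vectors with leading coefficient `1`. -/
theorem exists_sub_mem_span_reduced {K : Type*} [Field K] {ι : Type*} {m : ℕ}
    {P : ι → Fin m → K[X]} {u : ι → Fin m × ℕ} (hu : ∀ i, IsLeading (P i) (u i))
    (hmonic : ∀ i, vcoeff (P i) (u i) = 1) (v : Fin m → K[X]) :
    ∃ y, v - y ∈ Submodule.span K[X] (Set.range P) ∧
      ∀ i w, vcoeff y w ≠ 0 → ¬ MonomialDvd (u i) w := by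
  -- Induction on a strict bound for the ranks of the monomials: the top monomial is either
  -- cancelled by a multiple of some `P i` or moves to the remainder.
  suffices H : ∀ (n : ℕ) (v : Fin m → K[X]), (∀ w, vcoeff v w ≠ 0 → topRank w < n) →
      ∃ y, v - y ∈ Submodule.span K[X] (Set.range P) ∧
        ∀ i w, vcoeff y w ≠ 0 → ¬ MonomialDvd (u i) w by
    by_cases hv : v = 0
    · exact H 0 v fun w hw => absurd (by simp [hv, vcoeff]) hw
    · obtain ⟨w, hw⟩ := exists_isLeading hv
      exact H (topRank w + 1) v fun w' hw' => Nat.lt_succ_of_le (topLE_iff.1 (hw.2 w' hw'))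
  intro n
  induction n with
  | zero => exact fun v hv => ⟨v, by simp, fun i w hw => absurd (hv w hw) (Nat.not_lt_zero _)⟩
  | succ n ih =>
    intro v hv
    by_cases hn : ∃ w, vcoeff v w ≠ 0 ∧ topRank w = n
    · obtain ⟨w, hw, rfl⟩ := hn
      have hlt : ∀ v' : Fin m → K[X], vcoeff v' w = 0 →
          (∀ w', vcoeff v' w' ≠ 0 → topRank w' ≤ topRank w) →
          ∀ w', vcoeff v' w' ≠ 0 → topRank w' < topRank w := by
        intro v' h0 hle w' hw'
        refine lt_of_le_of_ne (hle w' hw') fun h => hw' ?_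
        rw [topRank_injective h, h0]
      by_cases hd : ∃ i, MonomialDvd (u i) w
      · obtain ⟨i, hi1, hi2⟩ := hd
        set c : K[X] := monomial (w.2 - (u i).2) (vcoeff v w) with hc
        have hcd : c.natDegree = w.2 - (u i).2 := natDegree_monomial_eq _ hw
        have hcw : ((u i).1, c.natDegree + (u i).2) = w := by
          ext1
          · exact hi1
          · simp only [hcd]
            omega
        have h0 : vcoeff (v - c • P i) w = 0 := by
          have := (hu i).vcoeff_smul c
          rw [hcw, hmonic, hc, leadingCoeff_monomial, mul_one] at this
          rw [vcoeff_sub, this, sub_self]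
        have hle : ∀ w', vcoeff (v - c • P i) w' ≠ 0 → topRank w' ≤ topRank w := by
          intro w' hw'
          by_cases h : vcoeff v w' = 0
          · rw [vcoeff_sub, h, zero_sub, neg_ne_zero] at hw'
            have := (hu i).topLE_smul hw'
            rwa [hcw, topLE_iff] at this
          · exact Nat.le_of_lt_succ (hv w' h)
        obtain ⟨y, hy, hred⟩ := ih _ (hlt _ h0 hle)
        refine ⟨y, ?_, hred⟩
        have := Submodule.add_mem _ hy
          (Submodule.smul_mem _ c (Submodule.subset_span (Set.mem_range_self i)))
        rwa [show v - c • P i - y + c • P i = v - y by abel] at this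
      · set z : Fin m → K[X] := Pi.single w.1 (monomial w.2 (vcoeff v w)) with hz
        have h0 : vcoeff (v - z) w = 0 := by
          rw [vcoeff_sub, hz, vcoeff_single, if_pos rfl, sub_self]
        have hle : ∀ w', vcoeff (v - z) w' ≠ 0 → topRank w' ≤ topRank w := by
          intro w' hw'
          rw [vcoeff_sub, hz, vcoeff_single] at hw'
          split_ifs at hw' with h
          · rw [h]
          · rw [sub_zero] at hw'
            exact Nat.le_of_lt_succ (hv w' hw')
        obtain ⟨y, hy, hred⟩ := ih _ (hlt _ h0 hle)
        refine ⟨y + z, by rwa [show v - (y + z) = v - z - y by abel], fun i w' hw' => ?_⟩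
        by_cases h : w' = w
        · rw [h]
          exact fun h' => hd ⟨i, h'⟩
        · refine hred i w' ?_
          have hz' : vcoeff z w' = 0 := by rw [hz, vcoeff_single, if_neg h]
          rwa [show vcoeff (y + z) w' = vcoeff y w' + vcoeff z w' by simp [vcoeff], hz',
            add_zero] at hw'
    · refine ih v fun w hw => lt_of_le_of_ne (Nat.le_of_lt_succ (hv w hw)) fun h => hn ⟨w, hw, h⟩

/-! ### Popov normal forms -/

theorem MonomialDvd.total {m : ℕ} {u w : Fin m × ℕ} (h : u.1 = w.1) :
    MonomialDvd u w ∨ MonomialDvd w u :=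
  (le_total u.2 w.2).imp (fun h' => ⟨h, h'⟩) fun h' => ⟨h.symm, h'⟩

/-- By minimality, the leading monomials of a Popov normal form sit at distinct positions. -/
theorem IsPopov.linearIndependent {K : Type*} [Field K] {ι : Type*} {m : ℕ}
    {P : Matrix ι (Fin m) K[X]} (hP : IsPopov P) : LinearIndependent K[X] P.row := by
  choose u hu _ using hP.monic
  refine linearIndependent_of_isLeading hu fun i j hij => ?_
  by_contra hne
  rcases MonomialDvd.total hij with h | h
  · exact hP.minimal i j _ _ hne (hu i) (hu j) h
  · exact hP.minimal j i _ _ (Ne.symm hne) (hu j) (hu i) h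

theorem IsPopov.exists_division {K : Type*} [Field K] {ι κ : Type*} [Fintype ι] {m : ℕ}
    {P : Matrix ι (Fin m) K[X]} (hP : IsPopov P) (C : Matrix κ (Fin m) K[X]) :
    ∃ (X : Matrix κ ι K[X]) (Y : Matrix κ (Fin m) K[X]), C = X * P + Y ∧ IsReducedBy P Y := by
  choose u hu hmonic using hP.monic
  choose Y hY hred using fun k => exists_sub_mem_span_reduced hu hmonic (C.row k)
  choose X hX using fun k => (Submodule.mem_span_range_iff_exists_fun K[X]).1 (hY k)
  refine ⟨Matrix.of X, Matrix.of Y, ?_, ?_⟩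
  · ext1 k j
    have h := congrFun (hX k) j
    simp only [Finset.sum_apply, Pi.smul_apply, smul_eq_mul, Pi.sub_apply] at h
    rw [Matrix.add_apply, Matrix.mul_apply, Matrix.of_apply]
    exact (sub_eq_iff_eq_add.1 h.symm)
  · intro k i v w hv hw
    rw [hv.unique (hu i)]
    exact hred k i w hw

/-- A row that is reduced with respect to a Popov normal form lies in its row module only if it
vanishes. -/
theorem IsPopov.eq_zero_of_isReducedBy {K : Type*} [Field K] {ι κ : Type*} {m : ℕ}
    {P : Matrix ι (Fin m) K[X]} (hP : IsPopov P) {Y : Matrix κ (Fin m) K[X]}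
    (hY : IsReducedBy P Y) {k : κ} (hk : Y.row k ∈ Submodule.span K[X] (Set.range P.row)) :
    Y.row k = 0 := by
  by_contra hne
  obtain ⟨i, u, w, hu, hw, hd⟩ := hP.groebner _ hk hne
  exact hY k i u w hu hw.1 hd

theorem IsPopov.submatrix {K : Type*} [Field K] {ι κ : Type*} {m : ℕ}
    {P : Matrix ι (Fin m) K[X]} (hP : IsPopov P) (e : κ ≃ ι) : IsPopov (P.submatrix e id) where
  monic i := hP.monic (e i)
  groebner f hf hf0 := by
    have hr : Set.range (P.submatrix e id).row = Set.range P.row := e.surjective.range_comp P.row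
    rw [hr] at hf
    obtain ⟨i, u, w, hu, hw, hd⟩ := hP.groebner f hf hf0
    refine ⟨e.symm i, u, w, ?_, hw, hd⟩
    change IsLeading (P.row (e (e.symm i))) u
    rwa [e.apply_symm_apply]
  minimal i j u w hij := hP.minimal (e i) (e j) u w (e.injective.ne hij)

/-- Every submodule of `K[σ]^m` has a minimal Gröbner basis, indexed by the set of positions at
which leading monomials occur: at each of them, an element whose leading monomial has least
degree. -/
theorem exists_isPopov_span_eq {K : Type*} [Field K] {m : ℕ} (N : Submodule K[X] (Fin m → K[X])) :
    ∃ (S : Set (Fin m)) (P : Matrix S (Fin m) K[X]),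
      IsPopov P ∧ Submodule.span K[X] (Set.range P.row) = N := by
  classical
  let S : Set (Fin m) := {p | ∃ a, ∃ v ∈ N, IsLeading v (p, a)}
  have hS : ∀ p : S, ∃ a, ∃ v ∈ N, IsLeading v (p.1, a) := fun p => p.2
  let a : S → ℕ := fun p => Nat.find (hS p)
  have ha : ∀ p : S, ∃ v ∈ N, IsLeading v (p.1, a p) ∧ vcoeff v (p.1, a p) = 1 := by
    intro p
    obtain ⟨v, hv, hl⟩ := Nat.find_spec (hS p)
    refine ⟨C (vcoeff v (p.1, a p))⁻¹ • v, N.smul_mem _ hv, ?_, ?_⟩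
    · have hc : ∀ w, vcoeff (C (vcoeff v (p.1, a p))⁻¹ • v) w =
          (vcoeff v (p.1, a p))⁻¹ * vcoeff v w := by
        intro w
        simp [vcoeff]
      refine ⟨?_, fun w hw => hl.2 w ?_⟩
      · rw [hc]
        exact mul_ne_zero (inv_ne_zero hl.1) hl.1
      · rw [hc] at hw
        exact right_ne_zero_of_mul hw
    · have : vcoeff (C (vcoeff v (p.1, a p))⁻¹ • v) (p.1, a p) =
          (vcoeff v (p.1, a p))⁻¹ * vcoeff v (p.1, a p) := by simp [vcoeff]
      rw [this, inv_mul_cancel₀ hl.1]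
  choose P hPN hPl hP1 using ha
  have hG : ∀ f ∈ N, f ≠ 0 → ∃ i w, IsLeading f w ∧ MonomialDvd (i.1, a i) w := by
    intro f hf hf0
    obtain ⟨w, hw⟩ := exists_isLeading hf0
    exact ⟨⟨w.1, w.2, f, hf, hw⟩, w, hw, rfl, Nat.find_min' _ ⟨f, hf, hw⟩⟩
  have hle : Submodule.span K[X] (Set.range P) ≤ N := by
    rw [Submodule.span_le]
    rintro _ ⟨i, rfl⟩
    exact hPN i
  have hspan : Submodule.span K[X] (Set.range P) = N := by
    refine le_antisymm hle fun v hv => ?_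
    obtain ⟨y, hy, hred⟩ := exists_sub_mem_span_reduced hPl hP1 v
    have hyN : y ∈ N := by
      have := N.sub_mem hv (hle hy)
      rwa [sub_sub_cancel] at this
    have hy0 : y = 0 := by
      by_contra hne
      obtain ⟨i, w, hw, hd⟩ := hG y hyN hne
      exact hred i w hw.1 hd
    rwa [hy0, sub_zero] at hy
  refine ⟨S, Matrix.of P, ⟨fun i => ⟨_, hPl i, hP1 i⟩, fun f hf hf0 => ?_, ?_⟩, hspan⟩
  · obtain ⟨i, w, hw, hd⟩ := hG f (hle hf) hf0
    exact ⟨i, _, w, hPl i, hw, hd⟩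
  · intro i j u w hij hu hw hd
    rw [hu.unique (hPl i), hw.unique (hPl j)] at hd
    exact hij (Subtype.ext hd.1)

/-- A basis of the image of a linear map on a free module over a principal ideal domain lifts and
extends, by a basis of the kernel, to a basis of the domain. -/
theorem exists_basis_map_eq {R V M : Type*} [CommRing R] [IsDomain R] [IsPrincipalIdealRing R]
    [AddCommGroup V] [Module R V] [Module.Free R V] [Module.Finite R V]
    [AddCommGroup M] [Module R M]
    (φ : V →ₗ[R] M) {ι : Type*} {w : ι → M} (hw : LinearIndependent R w)
    (hspan : Submodule.span R (Set.range w) = LinearMap.range φ) :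
    ∃ (n : ℕ) (B : Module.Basis (ι ⊕ Fin n) R V),
      (∀ i, φ (B (Sum.inl i)) = w i) ∧ ∀ k, φ (B (Sum.inr k)) = 0 := by
  obtain ⟨n, ⟨c⟩⟩ := Submodule.nonempty_basis_of_pid (Module.finBasis R V) (LinearMap.ker φ)
  let b : Module.Basis ι R (LinearMap.range φ) :=
    (Module.Basis.span hw).map (LinearEquiv.ofEq _ _ hspan)
  have hb : ∀ i, (b i : M) = w i := fun i => by simp [b, Module.Basis.span_apply]
  have : Module.Free R (LinearMap.range φ) := Module.Free.of_basis b
  obtain ⟨l, hl⟩ := Module.projective_lifting_property φ.rangeRestrict LinearMap.id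
    φ.surjective_rangeRestrict
  have hex : Function.Exact (LinearMap.ker φ).subtype φ.rangeRestrict := by
    rw [LinearMap.exact_iff, LinearMap.ker_rangeRestrict, Submodule.range_subtype]
  obtain ⟨e, he₁, he₂⟩ :=
    hex.splitSurjectiveEquiv (LinearMap.ker φ).injective_subtype ⟨l, hl⟩
  have hφ : ∀ x, φ (e.symm x) = x.2 := by
    intro x
    have := LinearMap.congr_fun he₂ (e.symm x)
    simp at this
    exact congrArg Subtype.val this
  refine ⟨n, ((b.prod c).map ((LinearEquiv.prodComm R _ _).trans e.symm)), fun i => ?_, fun k => ?_⟩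
  · simp [hφ, hb]
  · simp [hφ]

/-- Every square matrix over `K[σ]` has a Popov normal form: a minimal Gröbner basis of the row
module is a basis, so the map `c ↦ c M` onto the row module splits, and the lifted basis
together with a basis of the kernel forms the rows of the transformation. -/
theorem exists_unit_isPopov {K : Type*} [Field K] {m : ℕ} (M : Matrix (Fin m) (Fin m) K[X]) :
    ∃ (X : (Matrix (Fin m) (Fin m) K[X])ˣ) (r : ℕ), r ≤ m ∧
      IsPopov (upperRows r ((X : Matrix (Fin m) (Fin m) K[X]) * M)) ∧
      lowerRows r ((X : Matrix (Fin m) (Fin m) K[X]) * M) = 0 := by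
  classical
  obtain ⟨S, P, hP, hspan⟩ := exists_isPopov_span_eq (LinearMap.range M.vecMulLinear)
  obtain ⟨n, B, hB, hB0⟩ := exists_basis_map_eq M.vecMulLinear hP.linearIndependent hspan
  have hcard : Fintype.card S + n = m := by
    have := Fintype.card_congr (B.indexEquiv (Pi.basisFun K[X] (Fin m)))
    simpa using this
  set r := Fintype.card S
  let e₁ : {i : Fin m // (i : ℕ) < r} ≃ S := Fintype.equivOfCardEq <| by
    rw [Fintype.card_subtype, Fin.card_filter_val_lt, min_eq_right (by omega)]
  let e₂ : {i : Fin m // ¬ (i : ℕ) < r} ≃ Fin n := Fintype.equivOfCardEq <| by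
    rw [Fintype.card_subtype_compl, Fintype.card_subtype, Fin.card_filter_val_lt, Fintype.card_fin,
      Fintype.card_fin]
    omega
  let e : Fin m ≃ S ⊕ Fin n := (Equiv.sumCompl fun i : Fin m => (i : ℕ) < r).symm.trans
    (e₁.sumCongr e₂)
  let B' : Module.Basis (Fin m) K[X] (Fin m → K[X]) := B.reindex e.symm
  obtain ⟨X, hX⟩ : IsUnit (Matrix.of fun i => B' i) := by
    have := (Pi.basisFun K[X] (Fin m)).invertibleToMatrix B'
    have h := isUnit_of_invertible ((Pi.basisFun K[X] (Fin m)).toMatrix B')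
    rw [← Matrix.isUnit_transpose] at h
    convert h
    ext1 i j
    simp [Module.Basis.toMatrix_apply]
  have hrow : ∀ i j, ((X : Matrix (Fin m) (Fin m) K[X]) * M) i j = M.vecMulLinear (B' i) j := by
    intro i j
    rw [hX]
    rfl
  refine ⟨X, r, by omega, ?_, ?_⟩
  · convert hP.submatrix e₁
    ext1 i j
    have := hrow i.1 j
    have he : e i.1 = Sum.inl (e₁ i) := by
      simp [e]
    simp only [B', Module.Basis.reindex_apply, Equiv.symm_symm, he, hB] at this
    exact this
  · ext1 i j
    have := hrow i.1 j
    have he : e i.1 = Sum.inr (e₂ i) := by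
      simp [e]
    simp only [B', Module.Basis.reindex_apply, Equiv.symm_symm, he, hB0] at this
    exact this

/-! ### Null vectors over the operator ring -/

theorem smul_ne_zero_of_ne_zero {K : Type*} [Field K] {q : Kˣ} (n : Multiplicative ℕ) {p : QPoly q}
    (hp : p ≠ 0) : n • p ≠ 0 := by
  obtain ⟨p, rfl⟩ := (QPoly.of q).surjective p
  intro h
  refine hp ?_
  have hp0 : p = 0 := by
    ext i
    have := coeff_iterate_φ q p n.toAdd i
    rw [SkewPolynomial.φ_iterate_apply, ofAdd_toAdd, h, map_zero, coeff_zero] at this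
    exact (mul_eq_zero.1 this.symm).resolve_left (pow_ne_zero _ q.ne_zero)
  rw [hp0, map_zero]

/-- The product of the leading terms in `σ` does not vanish, as the `q`-shift is injective. -/
instance {K : Type*} [Field K] (q : Kˣ) : NoZeroDivisors (OpPoly q) where
  eq_zero_or_eq_zero_of_mul_eq_zero {f g} h := by
    classical
    by_contra! hne
    have hf : (SkewPolynomial.support f).Nonempty :=
      Finset.nonempty_iff_ne_empty.2 fun h' => hne.1 (SkewPolynomial.support_eq_empty.1 h')
    have hg : (SkewPolynomial.support g).Nonempty :=
      Finset.nonempty_iff_ne_empty.2 fun h' => hne.2 (SkewPolynomial.support_eq_empty.1 h')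
    obtain ⟨a, ha, hamax⟩ := (SkewPolynomial.support f).exists_max_image id hf
    obtain ⟨b, hb, hbmax⟩ := (SkewPolynomial.support g).exists_max_image id hg
    have hc := SkewMonoidAlgebra.coeff_mul_antidiagonal_of_finset f g
      (Multiplicative.ofAdd a * Multiplicative.ofAdd b)
      ((Finset.HasAntidiagonal.antidiagonal (a + b)).map (Equiv.prodCongr Multiplicative.ofAdd
        Multiplicative.ofAdd).toEmbedding) (by
          rintro ⟨x, y⟩
          simp [← ofAdd_add, Multiplicative.ext_iff])
    rw [h, Finset.sum_map, Finset.sum_eq_single_of_mem (a, b) (by simp)] at hc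
    · rw [SkewPolynomial.mem_support_iff] at ha hb
      exact mul_ne_zero (M₀ := K[X]) ha
        (smul_ne_zero_of_ne_zero (Multiplicative.ofAdd a) hb) hc.symm
    · rintro ⟨c, d⟩ hcd hne'
      rw [Finset.HasAntidiagonal.mem_antidiagonal] at hcd
      change SkewPolynomial.coeff f c * Multiplicative.ofAdd c • SkewPolynomial.coeff g d = 0
      by_cases hc' : SkewPolynomial.coeff f c = 0
      · rw [hc', zero_mul]
      by_cases hd' : SkewPolynomial.coeff g d = 0
      · rw [hd', smul_zero, mul_zero]
      have h1 := hamax c (SkewPolynomial.mem_support_iff.2 hc')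
      have h2 := hbmax d (SkewPolynomial.mem_support_iff.2 hd')
      simp only [id] at h1 h2 hcd
      exact absurd (Prod.ext (by simp only []; omega) (by simp only []; omega)) hne'

/-- Fewer than `m` homogeneous equations in `m` unknowns with coefficients on the left have a
nontrivial solution over the operator ring. -/
theorem exists_mulVec_eq_zero_of_card_lt {R ι κ : Type*} [Ring R] [StrongRankCondition Rᵐᵒᵖ]
    [Fintype ι] [Fintype κ] (h : Fintype.card ι < Fintype.card κ) (U : Matrix ι κ R) :
    ∃ g : κ → R, g ≠ 0 ∧ U.mulVec g = 0 := by
  by_contra! hU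
  refine absurd (card_le_of_injective Rᵐᵒᵖ
    (Matrix.vecMulLinear (Matrix.of fun j i => MulOpposite.op (U i j))) ?_) (not_le.2 h)
  refine (injective_iff_map_eq_zero _).2 fun x hx => ?_
  by_contra hne
  refine hU (fun j => (x j).unop) (fun h0 => hne ?_) ?_
  · funext j
    exact MulOpposite.unop_injective (congrFun h0 j)
  · funext i
    apply MulOpposite.op_injective
    have := congrFun hx i
    simpa [Matrix.vecMul, Matrix.mulVec, dotProduct] using this

/-- A square matrix with left linearly independent rows has no right null vector: any standard basis
vector has a nonzero left multiple in the row module. -/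
theorem mulVec_ne_zero_of_linearIndependent {R ι : Type*} [Ring R] [NoZeroDivisors R]
    [StrongRankCondition R] [Fintype ι] {A : Matrix ι ι R} (hA : LinearIndependent R A.row)
    {g : ι → R} (hg : g ≠ 0) : A.mulVec g ≠ 0 := by
  classical
  intro h
  obtain ⟨j, hj⟩ := Function.ne_iff.1 hg
  have hninj : ¬ Function.Injective (Matrix.vecMulLinear
      (Matrix.of (Sum.elim A fun _ : Unit => Pi.single j 1) : Matrix (ι ⊕ Unit) ι R)) := by
    intro hinj
    have := card_le_of_injective R _ hinj
    simp at this
  rw [injective_iff_map_eq_zero] at hninj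
  push Not at hninj
  obtain ⟨c, hc, hc0⟩ := hninj
  have hsum : Matrix.vecMul (fun i => c (Sum.inl i)) A + c (Sum.inr ()) • Pi.single j 1 = 0 := by
    rw [← hc]
    funext k
    simp only [Matrix.vecMulLinear_apply, Matrix.vecMul, dotProduct, Pi.add_apply, Pi.smul_apply,
      smul_eq_mul, Matrix.of_apply, Fintype.sum_sum_type, Finset.univ_unique, Finset.sum_singleton]
    rfl
  have hd : c (Sum.inr ()) * g j = 0 := by
    have := congrArg (fun v => v ⬝ᵥ g) hsum
    simpa [add_dotProduct, ← Matrix.dotProduct_mulVec, h] using this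
  rcases mul_eq_zero.1 hd with h0 | h0
  · rw [h0, zero_smul, add_zero] at hsum
    have hl : (fun i => c (Sum.inl i)) = 0 :=
      Matrix.vecMul_injective_iff.2 hA (by simpa using hsum)
    refine hc0 (funext fun x => ?_)
    rcases x with i | ⟨⟩
    · exact congrFun hl i
    · exact h0
  · exact hj h0

/-! ### Regularity and equivalence -/

theorem IsRegular.linearIndependent {K : Type*} [Field K] {q : Kˣ} {m : ℕ}
    {A : Matrix (Fin m) (Fin m) (OpPoly q)} (hA : IsRegular A) :
    LinearIndependent (OpPoly q) A.row := by
  rw [← Matrix.vecMul_injective_iff]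
  have h := Matrix.vecMul_injective_iff.2 hA
  intro v w hvw
  have := @h (fun i => opEmb q (v i)) (fun i => opEmb q (w i)) ?_
  · exact funext fun i => opEmb_injective q (congrFun this i)
  · funext j
    have := congrArg (opEmb q) (congrFun hvw j)
    simpa [Matrix.vecMul, dotProduct] using this

/-- Regularity is preserved under equivalence, so that it holds throughout the algorithm. -/
theorem IsEquivalent.isRegular {K : Type*} [Field K] {q : Kˣ} {m : ℕ}
    {A B : Matrix (Fin m) (Fin m) (OpPoly q)} (h : IsEquivalent A B) (hA : IsRegular A) :
    IsRegular B := by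
  obtain ⟨Q, hQ⟩ := h
  rw [IsRegular, ← Matrix.vecMul_injective_iff] at hA ⊢
  intro v w hvw
  simp only [hQ, ← Matrix.vecMul_vecMul] at hvw
  have := congrArg (fun x => Matrix.vecMul x (↑Q⁻¹ : Matrix (Fin m) (Fin m) (OpRat q))) (hA hvw)
  simpa [Matrix.vecMul_vecMul] using this

theorem IsEquivalent.refl {K : Type*} [Field K] {q : Kˣ} {m : ℕ}
    (A : Matrix (Fin m) (Fin m) (OpPoly q)) : IsEquivalent A A :=
  ⟨1, by simp⟩

theorem IsEquivalent.trans {K : Type*} [Field K] {q : Kˣ} {m : ℕ}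
    {A B D : Matrix (Fin m) (Fin m) (OpPoly q)} (h : IsEquivalent A B) (h' : IsEquivalent B D) :
    IsEquivalent A D := by
  obtain ⟨Q, hQ⟩ := h
  obtain ⟨Q', hQ'⟩ := h'
  exact ⟨Q' * Q, by rw [hQ', hQ, Units.val_mul, Matrix.mul_assoc]⟩

theorem isEquivalent_sigmaEmb_mul {K : Type*} [Field K] {q : Kˣ} {m : ℕ}
    {X : Matrix (Fin m) (Fin m) K[X]} (hX : IsUnit X) (A : Matrix (Fin m) (Fin m) (OpPoly q)) :
    IsEquivalent A (X.map (sigmaEmb q) * A) := by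
  obtain ⟨Q, hQ⟩ := hX.map (((opEmb q).comp (sigmaEmb q)).mapMatrix)
  refine ⟨Q, ?_⟩
  rw [hQ, Matrix.map_mul]
  rfl

theorem isEquivalent_of_shift {K : Type*} [Field K] {q : Kˣ} {m r : ℕ}
    {A A' : Matrix (Fin m) (Fin m) (OpPoly q)}
    (h : A'.map (opEmb q) = shiftMatrix q m r * A.map (opEmb q)) : IsEquivalent A A' := by
  have hX : QRat.of q (RatFunc.X : RatFunc K)⁻¹ * QRat.of q RatFunc.X = 1 := by
    rw [← map_mul, inv_mul_cancel₀ RatFunc.X_ne_zero, map_one]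
  let D : Matrix (Fin m) (Fin m) (OpRat q) := Matrix.diagonal fun i =>
    if (i : ℕ) < r then 1 else SkewPolynomial.C (QRat.of q RatFunc.X)
  refine ⟨⟨shiftMatrix q m r, D, ?_, ?_⟩, h⟩
  · rw [shiftMatrix, Matrix.diagonal_mul_diagonal, ← Matrix.diagonal_one]
    congr 1
    funext i
    split_ifs
    · rw [one_mul]
    · rw [← SkewPolynomial.C_mul, hX, SkewPolynomial.C_1]
  · rw [shiftMatrix, Matrix.diagonal_mul_diagonal, ← Matrix.diagonal_one]
    congr 1
    funext i
    split_ifs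
    · rw [one_mul]
    · rw [← SkewPolynomial.C_mul, mul_comm, hX, SkewPolynomial.C_1]

/-- Multiplication by `T` in terms of the entries over `K[t,σ]`. -/
theorem shift_iff {K : Type*} [Field K] {q : Kˣ} {m r : ℕ}
    {A A' : Matrix (Fin m) (Fin m) (OpPoly q)} :
    A'.map (opEmb q) = shiftMatrix q m r * A.map (opEmb q) ↔
      ∀ i j : Fin m, (if (i : ℕ) < r then A' i j else tOp q * A' i j) = A i j := by
  have hX : QRat.of q (RatFunc.X : RatFunc K)⁻¹ * QRat.of q RatFunc.X = 1 := by
    rw [← map_mul, inv_mul_cancel₀ RatFunc.X_ne_zero, map_one]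
  rw [← Matrix.ext_iff]
  refine forall_congr' fun i => forall_congr' fun j => ?_
  rw [shiftMatrix, Matrix.diagonal_mul, Matrix.map_apply, Matrix.map_apply]
  split_ifs with hi
  · rw [one_mul]
    exact (opEmb_injective q).eq_iff
  · constructor
    · intro h
      apply opEmb_injective q
      rw [map_mul, h, opEmb_tOp, ← mul_assoc, ← SkewPolynomial.C_mul, mul_comm (QRat.of q _), hX,
        SkewPolynomial.C_1, one_mul]
    · intro h
      rw [← h, map_mul, opEmb_tOp, ← mul_assoc, ← SkewPolynomial.C_mul, hX, SkewPolynomial.C_1,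
        one_mul]

theorem isUnit_reductionMatrix {R : Type*} [CommRing R] {m r : ℕ}
    (X : Matrix {i : Fin m // ¬ (i : ℕ) < r} {i : Fin m // (i : ℕ) < r} R) :
    IsUnit (reductionMatrix r X) := by
  rw [Matrix.isUnit_iff_isUnit_det, reductionMatrix, Matrix.det_reindex_self,
    Matrix.det_fromBlocks_zero₁₂]
  simp

theorem reductionMatrix_mulVec_upper {R S : Type*} [CommRing R] [Ring S] {m r : ℕ}
    (X : Matrix {i : Fin m // ¬ (i : ℕ) < r} {i : Fin m // (i : ℕ) < r} R) (f : R →+* S)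
    (v : Fin m → S) (i : {i : Fin m // (i : ℕ) < r}) :
    ((reductionMatrix r X).map f).mulVec v i = v i := by
  rw [Matrix.mulVec, dotProduct, ← (Equiv.sumCompl fun i : Fin m => (i : ℕ) < r).sum_comp,
    Fintype.sum_sum_type]
  simp [reductionMatrix, Matrix.one_apply, apply_ite f]

theorem reductionMatrix_mulVec_lower {R S : Type*} [CommRing R] [Ring S] {m r : ℕ}
    (X : Matrix {i : Fin m // ¬ (i : ℕ) < r} {i : Fin m // (i : ℕ) < r} R) (f : R →+* S)
    (v : Fin m → S) (i : {i : Fin m // ¬ (i : ℕ) < r}) :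
    ((reductionMatrix r X).map f).mulVec v i = v i - ∑ k, f (X i k) * v k := by
  rw [Matrix.mulVec, dotProduct, ← (Equiv.sumCompl fun i : Fin m => (i : ℕ) < r).sum_comp,
    Fintype.sum_sum_type]
  simp [reductionMatrix, Matrix.one_apply, apply_ite f, neg_add_eq_sub]

theorem trailingMatrix_sigmaEmb_mul {K : Type*} [Field K] {q : Kˣ} {m : ℕ}
    (X : Matrix (Fin m) (Fin m) K[X]) (A : Matrix (Fin m) (Fin m) (OpPoly q)) :
    trailingMatrix (X.map (sigmaEmb q) * A) = X * trailingMatrix A := by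
  rw [trailingMatrix_eq_map, Matrix.map_mul, Matrix.map_map]
  congr 1
  ext1 i j
  exact trailingHom_sigmaEmb q _

theorem upperRows_trailingMatrix_reduction {K : Type*} [Field K] {q : Kˣ} {m r : ℕ}
    (X : Matrix {i : Fin m // ¬ (i : ℕ) < r} {i : Fin m // (i : ℕ) < r} K[X])
    (A : Matrix (Fin m) (Fin m) (OpPoly q)) :
    upperRows r (trailingMatrix ((reductionMatrix r X).map (sigmaEmb q) * A)) =
      upperRows r (trailingMatrix A) := by
  rw [trailingMatrix_sigmaEmb_mul]
  ext1 i j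
  have := reductionMatrix_mulVec_upper X (RingHom.id _) (fun k => trailingMatrix A k j) i
  rwa [RingHom.coe_id, Matrix.map_id] at this

theorem lowerRows_trailingMatrix_reduction {K : Type*} [Field K] {q : Kˣ} {m r : ℕ}
    (X : Matrix {i : Fin m // ¬ (i : ℕ) < r} {i : Fin m // (i : ℕ) < r} K[X])
    (A : Matrix (Fin m) (Fin m) (OpPoly q)) :
    lowerRows r (trailingMatrix ((reductionMatrix r X).map (sigmaEmb q) * A)) =
      lowerRows r (trailingMatrix A) - X * upperRows r (trailingMatrix A) := by
  rw [trailingMatrix_sigmaEmb_mul]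
  ext1 i j
  have := reductionMatrix_mulVec_lower X (RingHom.id _) (fun k => trailingMatrix A k j) i
  rwa [RingHom.coe_id, Matrix.map_id] at this

theorem upperRows_trailingMatrix_shift {K : Type*} [Field K] {q : Kˣ} {m r : ℕ}
    {A A' : Matrix (Fin m) (Fin m) (OpPoly q)}
    (h : A'.map (opEmb q) = shiftMatrix q m r * A.map (opEmb q)) :
    upperRows r (trailingMatrix A') = upperRows r (trailingMatrix A) := by
  ext1 i j
  have := shift_iff.1 h i j
  rw [if_pos i.2] at this
  exact congrArg tTrailing this

/-- The polynomial `λ` is the determinant of the `t`-trailing matrix. -/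
theorem tailPoly_eq_det_trailingMatrix {K : Type*} [Field K] {q : Kˣ} {m : ℕ}
    (A : Matrix (Fin m) (Fin m) (OpPoly q)) : tailPoly A = (trailingMatrix A).det := by
  rw [tailPoly]
  congr 1
  ext i j k
  have h : ∀ k, (sigmaOrder A + 1) ≤ k → SkewPolynomial.coeff (A i j) k = 0 := by
    intro k hk
    by_contra hne
    rw [← ne_eq, ← SkewPolynomial.mem_support_iff] at hne
    have h1 := Finset.le_sup (f := id) hne
    have h2 := Finset.le_sup (f := fun j => (SkewPolynomial.support (A i j)).sup id)
      (Finset.mem_univ j)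
    have h3 := Finset.le_sup (f := fun i => Finset.univ.sup fun j =>
      (SkewPolynomial.support (A i j)).sup id) (Finset.mem_univ i)
    have : k ≤ sigmaOrder A := h1.trans (h2.trans h3)
    omega
  rw [Matrix.sum_apply, finsetSum_coeff]
  simp only [Matrix.smul_apply, Matrix.map_apply, smul_eq_mul, X_pow_mul_C, coeff_C_mul_X_pow]
  rw [Finset.sum_ite_eq, trailingMatrix, Matrix.map_apply, coeff_tTrailing]
  split_ifs with hk
  · rfl
  · rw [h k (by simpa using hk), map_zero, coeff_zero]

/-! ### Row modules of trailing matrices -/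

/-- The module generated by the rows of a matrix. -/
abbrev rowSpan {R ι : Type*} [Semiring R] {m : ℕ} (M : Matrix ι (Fin m) R) :
    Submodule R (Fin m → R) :=
  Submodule.span R (Set.range M.row)

theorem rowSpan_mul_le {R ι κ : Type*} [CommRing R] [Fintype κ] {m : ℕ} (X : Matrix ι κ R)
    (M : Matrix κ (Fin m) R) : rowSpan (X * M) ≤ rowSpan M := by
  rw [rowSpan, Submodule.span_le]
  rintro _ ⟨i, rfl⟩
  have : (X * M).row i = ∑ k, X i k • M.row k := by
    funext j
    simp [Matrix.mul_apply]
  rw [this]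
  exact Submodule.sum_mem _ fun k _ =>
    Submodule.smul_mem _ _ (Submodule.subset_span (Set.mem_range_self k))

theorem rowSpan_unit_mul {R : Type*} [CommRing R] {m : ℕ} (X : (Matrix (Fin m) (Fin m) R)ˣ)
    (M : Matrix (Fin m) (Fin m) R) :
    rowSpan ((X : Matrix (Fin m) (Fin m) R) * M) = rowSpan M := by
  refine le_antisymm (rowSpan_mul_le _ _) ?_
  have h := rowSpan_mul_le (↑X⁻¹ : Matrix (Fin m) (Fin m) R) ((X : Matrix (Fin m) (Fin m) R) * M)
  rwa [← Matrix.mul_assoc, Units.inv_mul, Matrix.one_mul] at h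

theorem rowSpan_upperRows_le {R : Type*} [Semiring R] {m : ℕ} (r : ℕ)
    (M : Matrix (Fin m) (Fin m) R) : rowSpan (upperRows r M) ≤ rowSpan M := by
  refine Submodule.span_mono ?_
  rintro _ ⟨i, rfl⟩
  exact ⟨i, rfl⟩

theorem rowSpan_upperRows_eq {R : Type*} [Semiring R] {m r : ℕ}
    {M : Matrix (Fin m) (Fin m) R} (h : lowerRows r M = 0) :
    rowSpan (upperRows r M) = rowSpan M := by
  refine le_antisymm (rowSpan_upperRows_le r M) (Submodule.span_le.2 ?_)
  rintro _ ⟨i, rfl⟩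
  by_cases hi : (i : ℕ) < r
  · exact Submodule.subset_span ⟨⟨i, hi⟩, rfl⟩
  · have : M.row i = 0 := funext fun j => congrFun (congrFun h ⟨i, hi⟩) j
    rw [this]
    exact Submodule.zero_mem _

/-- Adding nonzero reduced rows to a Popov normal form enlarges the row module. -/
theorem rowSpan_upperRows_lt {K : Type*} [Field K] {m r : ℕ} {M : Matrix (Fin m) (Fin m) K[X]}
    (hP : IsPopov (upperRows r M)) (hred : IsReducedBy (upperRows r M) (lowerRows r M))
    (hne : lowerRows r M ≠ 0) : rowSpan (upperRows r M) < rowSpan M := by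
  refine lt_of_le_of_ne (rowSpan_upperRows_le r M) fun h => hne ?_
  ext1 k j
  refine congrFun (hP.eq_zero_of_isReducedBy hred (k := k) ?_) j
  change _ ∈ rowSpan (upperRows r M)
  rw [h]
  exact Submodule.subset_span ⟨k, rfl⟩

/-- A singular matrix has a Popov normal form with fewer than `m` nonzero rows. -/
theorem lt_of_isPopov_upperRows {K : Type*} [Field K] {m r : ℕ} {M : Matrix (Fin m) (Fin m) K[X]}
    (hdet : M.det = 0) (hr : r ≤ m) (hP : IsPopov (upperRows r M)) : r < m := by
  refine lt_of_le_of_ne hr ?_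
  rintro rfl
  obtain ⟨v, hv, hvM⟩ := Matrix.exists_vecMul_eq_zero_iff.2 hdet
  have hli : LinearIndependent K[X] M.row :=
    hP.linearIndependent.comp (fun i => ⟨i, i.2⟩) fun i j h => congrArg Subtype.val h
  exact hv (Matrix.vecMul_injective_iff.2 hli (by simpa using hvM))

/-! ### Termination -/

/-- The inner loop terminates. The operators `(A g)_i`, for a fixed right null vector `g` of the
upper rows, are not affected by the reduction of the lower rows by the upper ones, and lose a
factor `t` with every multiplication by `T`; so the `t`-degree `n` of a fixed nonzero coefficient
bounds the number of iterations. The hypothesis `hacc` takes care of returns to the outer loop,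
which happen only with a larger row module of the trailing matrix. -/
theorem acc_inner {K : Type*} [Field K] {q : Kˣ} {m r : ℕ} (N : Submodule K[X] (Fin m → K[X]))
    (hacc : ∀ A : Matrix (Fin m) (Fin m) (OpPoly q), IsRegular A → N < rowSpan (trailingMatrix A) →
      Acc (flip Step) (State.outer A))
    (g : Fin m → OpPoly q) (i₀ : Fin m) (hi₀ : ¬ (i₀ : ℕ) < r) (s n : ℕ)
    (A : Matrix (Fin m) (Fin m) (OpPoly q)) (hA : IsRegular A)
    (hP : IsPopov (upperRows r (trailingMatrix A)))
    (hN : rowSpan (upperRows r (trailingMatrix A)) = N)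
    (hg : ∀ i : Fin m, (i : ℕ) < r → A.mulVec g i = 0)
    (hs : SkewPolynomial.coeff (A.mulVec g i₀) s ≠ 0)
    (hn : ((QPoly.of q).symm (SkewPolynomial.coeff (A.mulVec g i₀) s)).natDegree = n) :
    Acc (flip Step) (State.inner r A) := by
  induction n using Nat.strong_induction_on generalizing A with
  | _ n ih =>
  refine Acc.intro _ fun s₁ hs₁ => ?_
  cases hs₁ with
  | shift _ _ A' hA' =>
  have hA'reg : IsRegular A' := (isEquivalent_of_shift hA').isRegular hA
  have hg' : ∀ i : Fin m, (i : ℕ) < r → A'.mulVec g i = 0 := by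
    intro i hi
    rw [← hg i hi]
    simp only [Matrix.mulVec, dotProduct]
    refine Finset.sum_congr rfl fun j _ => ?_
    have := shift_iff.1 hA' i j
    rw [if_pos hi] at this
    rw [this]
  have ht : tOp q * A'.mulVec g i₀ = A.mulVec g i₀ := by
    simp only [Matrix.mulVec, dotProduct, Finset.mul_sum, ← mul_assoc]
    refine Finset.sum_congr rfl fun j _ => ?_
    have := shift_iff.1 hA' i₀ j
    rw [if_neg hi₀] at this
    rw [this]
  have hcoeff : X * (QPoly.of q).symm (SkewPolynomial.coeff (A'.mulVec g i₀) s) =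
      (QPoly.of q).symm (SkewPolynomial.coeff (A.mulVec g i₀) s) := by
    rw [← ht, tOp, SkewPolynomial.coeff_C_mul, map_mul, RingEquiv.symm_apply_apply]
  have hs' : SkewPolynomial.coeff (A'.mulVec g i₀) s ≠ 0 := by
    intro h
    rw [h, map_zero, mul_zero, eq_comm, map_eq_zero_iff _ (QPoly.of q).symm.injective] at hcoeff
    exact hs hcoeff
  have hdeg : ((QPoly.of q).symm (SkewPolynomial.coeff (A'.mulVec g i₀) s)).natDegree < n := by
    rw [← hn, ← hcoeff, natDegree_X_mul ((map_ne_zero_iff _ (QPoly.of q).symm.injective).2 hs')]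
    exact Nat.lt_succ_self _
  have hP' : IsPopov (upperRows r (trailingMatrix A')) :=
    (upperRows_trailingMatrix_shift hA').symm ▸ hP
  have hN' : rowSpan (upperRows r (trailingMatrix A')) = N :=
    (upperRows_trailingMatrix_shift hA').symm ▸ hN
  refine Acc.intro _ fun s₂ hs₂ => ?_
  cases hs₂ with
  | continueInner _ _ X =>
    -- The upper entries of `A' g` vanish, so subtracting multiples of them changes nothing.
    set B := (reductionMatrix r X).map (sigmaEmb q) * A' with hB
    have hBg : ∀ i : Fin m, B.mulVec g i = A'.mulVec g i := by
      intro i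
      rw [hB, ← Matrix.mulVec_mulVec]
      by_cases hi : (i : ℕ) < r
      · exact reductionMatrix_mulVec_upper X (sigmaEmb q) (A'.mulVec g) ⟨i, hi⟩
      · rw [reductionMatrix_mulVec_lower X (sigmaEmb q) (A'.mulVec g) ⟨i, hi⟩]
        rw [Finset.sum_eq_zero fun k _ => by rw [hg' k k.2, mul_zero], sub_zero]
    refine ih _ hdeg B ((isEquivalent_sigmaEmb_mul (isUnit_reductionMatrix X) A').isRegular hA'reg)
      ?_ ?_ (fun i hi => (hBg i).trans (hg' i hi)) ?_ ?_
    · rwa [upperRows_trailingMatrix_reduction]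
    · rwa [upperRows_trailingMatrix_reduction]
    · rwa [hBg]
    · rw [hBg]
  | backToOuter _ _ X Y hdiv hred hY =>
    refine hacc _
      ((isEquivalent_sigmaEmb_mul (isUnit_reductionMatrix X) A').isRegular hA'reg) ?_
    have hlow : lowerRows r (trailingMatrix ((reductionMatrix r X).map (sigmaEmb q) * A')) = Y := by
      rw [lowerRows_trailingMatrix_reduction, hdiv, add_sub_cancel_left]
    rw [← hN', ← upperRows_trailingMatrix_reduction X A']
    refine rowSpan_upperRows_lt ?_ ?_ ?_
    · rwa [upperRows_trailingMatrix_reduction]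
    · rwa [upperRows_trailingMatrix_reduction, hlow]
    · rwa [hlow]

/-- The algorithm terminates on every regular matrix, since the row module of the trailing matrix
grows from one pass of the outer loop to the next. -/
theorem acc_outer {K : Type*} [Field K] {q : Kˣ} {m : ℕ}
    (A : Matrix (Fin m) (Fin m) (OpPoly q)) (hA : IsRegular A) :
    Acc (flip Step) (State.outer A) := by
  induction hN : rowSpan (trailingMatrix A) using
    (wellFounded_gt (α := Submodule K[X] (Fin m → K[X]))).induction generalizing A with
  | _ N ih =>
  subst hN
  refine Acc.intro _ fun s hs => ?_
  cases hs with
  | ret _ hdet => exact Acc.intro _ fun s hs => nomatch hs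
  | popov _ hdet X r hr hP hzero =>
    have hdet' : ((X : Matrix (Fin m) (Fin m) K[X]) * trailingMatrix A).det = 0 := by
      rw [Matrix.det_mul, hdet, mul_zero]
    have hrm := lt_of_isPopov_upperRows hdet' hr hP
    set B := (X : Matrix (Fin m) (Fin m) K[X]).map (sigmaEmb q) * A with hB
    have hBreg : IsRegular B := (isEquivalent_sigmaEmb_mul X.isUnit A).isRegular hA
    have hBt : trailingMatrix B = X * trailingMatrix A := trailingMatrix_sigmaEmb_mul _ _
    obtain ⟨g, hg0, hg⟩ := exists_mulVec_eq_zero_of_card_lt (R := OpPoly q)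
      (by rw [Fintype.card_subtype, Fin.card_filter_val_lt, Fintype.card_fin]; omega)
      (upperRows r B)
    have hg' : ∀ i : Fin m, (i : ℕ) < r → B.mulVec g i = 0 := fun i hi => congrFun hg ⟨i, hi⟩
    obtain ⟨i₀, hi₀⟩ := Function.ne_iff.1
      (mulVec_ne_zero_of_linearIndependent hBreg.linearIndependent hg0)
    obtain ⟨s, hs⟩ : ∃ s, SkewPolynomial.coeff (B.mulVec g i₀) s ≠ 0 := by
      by_contra! h
      exact hi₀ (SkewMonoidAlgebra.ext fun s => h s.toAdd)
    refine acc_inner _ (fun A' hA' hlt => ih _ hlt A' hA' rfl) g i₀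
      (fun hi => hi₀ (hg' i₀ hi)) s _ B hBreg (hBt ▸ hP) ?_ hg' hs rfl
    rw [hBt, rowSpan_upperRows_eq hzero, rowSpan_unit_mul]

/-! ### Runs of the algorithm -/

/-- The matrix carried by a configuration. -/
def State.matrix {K : Type*} [Field K] {q : Kˣ} {m : ℕ} :
    State q m → Matrix (Fin m) (Fin m) (OpPoly q)
  | .outer A | .inner _ A | .reduce _ A | .returned A => A

/-- The property of the trailing matrix that holds at each stage of the algorithm. -/
def State.Invariant {K : Type*} [Field K] {q : Kˣ} {m : ℕ} : State q m → Prop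
  | .outer _ => True
  | .inner r A => IsPopov (upperRows r (trailingMatrix A)) ∧ lowerRows r (trailingMatrix A) = 0
  | .reduce r A => IsPopov (upperRows r (trailingMatrix A))
  | .returned A => (trailingMatrix A).det ≠ 0

theorem Step.isEquivalent {K : Type*} [Field K] {q : Kˣ} {m : ℕ} {s s' : State q m}
    (h : Step s s') : IsEquivalent s.matrix s'.matrix := by
  cases h with
  | ret A _ => exact .refl A
  | popov A _ X => exact isEquivalent_sigmaEmb_mul X.isUnit A
  | shift r A A' hA' => exact isEquivalent_of_shift hA'
  | continueInner r A X => exact isEquivalent_sigmaEmb_mul (isUnit_reductionMatrix X) A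
  | backToOuter r A X => exact isEquivalent_sigmaEmb_mul (isUnit_reductionMatrix X) A

theorem Step.invariant {K : Type*} [Field K] {q : Kˣ} {m : ℕ} {s s' : State q m}
    (h : Step s s') (hs : s.Invariant) : s'.Invariant := by
  cases h with
  | ret A hdet => exact hdet
  | popov A _ X r _ hP hzero =>
    rw [← trailingMatrix_sigmaEmb_mul] at hP hzero
    exact ⟨hP, hzero⟩
  | shift r A A' hA' =>
    change IsPopov _
    rw [upperRows_trailingMatrix_shift hA']
    exact hs.1
  | continueInner r A X Y hdiv _ hY =>
    refine ⟨?_, ?_⟩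
    · rw [upperRows_trailingMatrix_reduction]
      exact hs
    · rw [lowerRows_trailingMatrix_reduction, hdiv, hY, add_zero, sub_self]
  | backToOuter => trivial

/-- No configuration that can occur is stuck: the normal forms and divisions exist, and the lower
rows are divisible by `t` whenever they are to be multiplied by `t⁻¹`. -/
theorem State.Invariant.exists_step {K : Type*} [Field K] {q : Kˣ} {m : ℕ} {s : State q m}
    (hs : s.Invariant) : (∃ B, s = .returned B) ∨ ∃ s', Step s s' := by
  cases s with
  | returned B => exact Or.inl ⟨B, rfl⟩
  | outer A =>
    right
    by_cases hdet : (trailingMatrix A).det = 0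
    · obtain ⟨X, r, hr, hP, hzero⟩ := exists_unit_isPopov (trailingMatrix A)
      exact ⟨_, .popov A hdet X r hr hP hzero⟩
    · exact ⟨_, .ret A hdet⟩
  | inner r A =>
    right
    have h : ∀ i j : Fin m, ∃ f, (if (i : ℕ) < r then f else tOp q * f) = A i j := by
      intro i j
      split_ifs with hi
      · exact ⟨_, rfl⟩
      · exact exists_tOp_mul_eq (congrFun (congrFun hs.2 ⟨i, hi⟩) j)
    choose A' hA' using h
    exact ⟨_, .shift r A (Matrix.of A') (shift_iff.2 hA')⟩
  | reduce r A =>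
    right
    obtain ⟨X, Y, hdiv, hred⟩ := IsPopov.exists_division hs (lowerRows r (trailingMatrix A))
    by_cases hY : Y = 0
    · exact ⟨_, .continueInner r A X Y hdiv hred hY⟩
    · exact ⟨_, .backToOuter r A X Y hdiv hred hY⟩

theorem Reaches.invariant {K : Type*} [Field K] {q : Kˣ} {m : ℕ} {s s' : State q m}
    (h : Reaches s s') (hs : s.Invariant) : s'.Invariant := by
  induction h with
  | refl => exact hs
  | tail _ h ih => exact h.invariant ih

theorem Reaches.isEquivalent {K : Type*} [Field K] {q : Kˣ} {m : ℕ} {s s' : State q m}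
    (h : Reaches s s') : IsEquivalent s.matrix s'.matrix := by
  induction h with
  | refl => exact .refl _
  | tail _ h ih => exact ih.trans h.isEquivalent

theorem State.Invariant.exists_reaches_returned {K : Type*} [Field K] {q : Kˣ} {m : ℕ}
    {s : State q m} (hacc : Acc (flip Step) s) (hs : s.Invariant) :
    ∃ B, Reaches s (.returned B) := by
  induction hacc with
  | intro s _ ih =>
    rcases hs.exists_step with ⟨B, rfl⟩ | ⟨s', h⟩
    · exact ⟨B, .refl⟩
    · obtain ⟨B, hB⟩ := ih s' h (h.invariant hs)
      exact ⟨B, hB.head h⟩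

end
end QTail

theorem theorem4p1 {K : Type*} [Field K] [CharZero K] (q : Kˣ)
    (hq : ∀ n : ℕ, 0 < n → (q : K) ^ n ≠ 1) (m : ℕ)
    (A : Matrix (Fin m) (Fin m) (QTail.OpPoly q)) (hA : QTail.IsRegular A) :
    -- there is no infinite run of the algorithm on input `A`
    (¬ ∃ run : ℕ → QTail.State q m,
      run 0 = .outer A ∧ ∀ n, QTail.Step (run n) (run (n + 1))) ∧
    -- the algorithm never gets stuck before it has returned a matrix
    (∀ s, QTail.Reaches (.outer A) s →
      (∃ B, s = .returned B) ∨ ∃ s', QTail.Step s s') ∧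
    -- hence it returns a matrix
    (∃ B, QTail.Reaches (.outer A) (.returned B)) ∧
    -- every returned matrix is as specified
    (∀ B, QTail.Reaches (.outer A) (.returned B) →
      QTail.IsEquivalent A B ∧
      LinearIndependent (Polynomial K) (QTail.trailingMatrix B).row ∧
      QTail.IsTTailRegular B) := by
  have hinv : (QTail.State.outer A).Invariant := trivial
  have hacc := QTail.acc_outer A hA
  refine ⟨?_, fun s hs => (hs.invariant hinv).exists_step, hinv.exists_reaches_returned hacc,
    fun B hB => ⟨hB.isEquivalent, ?_, ?_⟩⟩
  · rintro ⟨run, h0, hrun⟩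
    exact (acc_iff_isEmpty_descending_chain.1 hacc).false ⟨run, h0, hrun⟩
  · exact Matrix.linearIndependent_rows_of_det_ne_zero (hB.invariant hinv)
  · rw [QTail.IsTTailRegular, QTail.tailPoly_eq_det_trailingMatrix]
    exact hB.invariant hinv
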